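/- Let $S=\mathbb{Z}\times\mathbb{R}_{\ge 0}$ with reference measure $\mu=\#_{\mathbb{Z}}\otimes\mathcal{L}(\mathbb{R}_{\ge0})$ (counting measure times Lebesgue measure). For $(x_1,u_1),(x_2,u_2)\in S$ put $$K_{\rm edge}(x_1,u_1;x_2,u_2)=\begin{cases}\displaystyle \frac{2}{\pi}\int_0^1 t^{x_2-x_1}\cos\!\left(tu_1+\tfrac{\pi}{2}x_1\right)\cos\!\left(tu_2+\tfrac{\pi}{2}x_2\right)dt, & x_2\ge x_1,\\[2ex] \displaystyle -\frac{2}{\pi}\int_1^{\infty} t^{x_2-x_1}\cos\!\left(tu_1+\tfrac{\pi}{2}x_1\right)\cos\!\left(tu_2+\tfrac{\pi}{2}x_2\right)dt, & x_2<x_1,\end{cases}$$ where $\int_1^\infty=\lim_{T\to\infty}\int_1^T$. A configuration is a subset of $S$ with finitely many points in every compact set; the space of configurations carries the sigma-algebra generated by the counts $X\mapsto\#(X\cap B)$, $B\subset S$ Borel. Let $\mathcal{X}_{\rm edge}$ be the determinantal point process on $S$ with correlation kernel $K_{\rm edge}$ and reference measure $\mu$, that is, a random configuration such that for every $k$ and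 every continuous, compactly supported $f:S^k\to\mathbb{R}$ the sum below is integrable and $$\mathbb{E}\Bigg[\sum_{\substack{(p_1,\dots,p_k)\in\mathcal{X}_{\rm edge}^k\\ p_1,\dots,p_k\text{ distinct}}} f(p_1,\dots,p_k)\Bigg]=\int_{S^k}\det\big[K_{\rm edge}(p_i,p_j)\big]_{i,j=1}^k\, f(p_1,\dots,p_k)\,\mu^{\otimes k}(dp_1,\dots,dp_k).$$ For $h\in\mathbb{Z}$ let $\tau^h$ act on configurations through the translation $(x,u)\mapsto(x+2h,u)$ of their points. Then $\mathcal{X}_{\rm edge}$ is ergodic with respect to the spatial translations: if $E$ is a measurable set of configurations with $\tau^hE=E$ for every $h\in\mathbb{Z}$, where $\tau^hE=\{\tau^h(\omega):\omega\in E\}$, then $\mathbb{P}(\mathcal{X}_{\rm edge}\in E)\in\{0,1\}$. -/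

import Mathlib

open MeasureTheory Filter Topology
open scoped NNReal

namespace EdgeProcess

/-! ### Simple point processes and determinantal point processes -/

/-- A simple discrete configuration in `S`: a set of points without accumulation points, that is,
with only finitely many points in every compact set. -/
@[ext]
structure Configuration (S : Type*) [TopologicalSpace S] where
  /-- The set of points of the configuration. -/
  points : Set S
  finite_inter : ∀ C : Set S, IsCompact C → (points ∩ C).Finite

/-- The sigma-algebra on configurations generated by all the counting variables `X ↦ #(X ∩ B)`,
`B` a Borel set. -/
noncomputable instance {S : Type*} [TopologicalSpace S] [MeasurableSpace S] :
    MeasurableSpace (Configuration S) :=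
  ⨆ B : {B : Set S // MeasurableSet B},
    MeasurableSpace.comap (fun X : Configuration S => (X.points ∩ B.1).encard) ⊤

/-- The `k`-tuples of pairwise distinct points of the configuration `X`. -/
def distinctTuples {S : Type*} [TopologicalSpace S] (k : ℕ) (X : Configuration S) :
    Set (Fin k → S) :=
  {p | Function.Injective p ∧ ∀ i, p i ∈ X.points}

/-- The sum of `f` over the `k`-tuples of distinct points of `X` (a sum with finitely many
non-zero terms when `f` has compact support). -/
noncomputable def tupleSum {S : Type*} [TopologicalSpace S] {k : ℕ} (f : (Fin k → S) → ℝ)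
    (X : Configuration S) : ℝ :=
  ∑' p : distinctTuples k X, f p.1

/-- The random configuration `X`, defined on `Ω` with probability `P`, is a determinantal point
process with correlation kernel `K` and reference measure `μ`. -/
structure IsDeterminantal {S : Type*} [TopologicalSpace S] [MeasurableSpace S]
    (K : S → S → ℝ) (μ : Measure S) {Ω : Type*} [MeasurableSpace Ω] (P : Measure Ω)
    (X : Ω → Configuration S) : Prop where
  measurable : Measurable X
  integrable : ∀ (k : ℕ) (f : (Fin k → S) → ℝ), Continuous f → HasCompactSupport f →
    Integrable (fun ω => tupleSum f (X ω)) P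
  expectation : ∀ (k : ℕ) (f : (Fin k → S) → ℝ), Continuous f → HasCompactSupport f →
    ∫ ω, tupleSum f (X ω) ∂P =
      ∫ p, (Matrix.of fun i j : Fin k => K (p i) (p j)).det * f p ∂(Measure.pi fun _ => μ)

/-! ### The edge kernel on `ℤ × ℝ≥0` -/

/-- Counting measure on `ℤ` times Lebesgue measure on `[0, ∞)`. -/
noncomputable def refMeasure : Measure (ℤ × ℝ≥0) :=
  (Measure.count : Measure ℤ).prod (Measure.comap ((↑) : ℝ≥0 → ℝ) volume)

/-- The function `t ↦ t ^ (x₂ - x₁) cos (t u₁ + π x₁ / 2) cos (t u₂ + π x₂ / 2)`. -/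
noncomputable def edgeIntegrand (x₁ : ℤ) (u₁ : ℝ≥0) (x₂ : ℤ) (u₂ : ℝ≥0) (t : ℝ) : ℝ :=
  t ^ (x₂ - x₁) * Real.cos (t * u₁ + Real.pi / 2 * x₁) * Real.cos (t * u₂ + Real.pi / 2 * x₂)

/-- The kernel `K_edge`. The integral over `[1, ∞)` is only conditionally convergent when
`x₂ = x₁ - 1`, so it is taken as the limit of the integrals over `[1, T]` as `T → ∞`;
`exists_tendsto_edgeIntegrand` below shows that this limit always exists. -/
noncomputable def edgeKernel (p q : ℤ × ℝ≥0) : ℝ :=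
  if p.1 ≤ q.1 then
    2 / Real.pi * ∫ t in (0 : ℝ)..1, edgeIntegrand p.1 p.2 q.1 q.2 t
  else
    -(2 / Real.pi) *
      limUnder atTop (fun T : ℝ => ∫ t in (1 : ℝ)..T, edgeIntegrand p.1 p.2 q.1 q.2 t)

theorem exists_tendsto_cos_div (c γ : ℝ) (h : c = 0 → Real.cos γ = 0) :
    ∃ l : ℝ, Tendsto (fun T : ℝ => ∫ t in (1 : ℝ)..T, t⁻¹ * Real.cos (c * t + γ)) atTop (𝓝 l) := by
  by_cases hc : c = 0
  · exact ⟨0, by simp [hc, h hc]⟩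
  have hint : IntegrableOn (fun t : ℝ => (t ^ 2)⁻¹ * (Real.sin (c * t + γ) / c)) (Set.Ioi 1) := by
    have h2 : IntegrableOn (fun t : ℝ => (t ^ 2)⁻¹) (Set.Ioi 1) := by
      refine (integrableOn_Ioi_rpow_of_lt (by norm_num : (-2 : ℝ) < -1) one_pos).congr_fun ?_
        measurableSet_Ioi
      intro t ht
      have : (0 : ℝ) < t := lt_trans one_pos ht
      simp only [Real.rpow_neg this.le]
      norm_num
    refine h2.mul_bdd (c := 1 / |c|) (by fun_prop) (ae_of_all _ fun t => ?_)
    rw [norm_div, Real.norm_eq_abs, Real.norm_eq_abs]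
    gcongr
    exact Real.abs_sin_le_one _
  have hlim := intervalIntegral_tendsto_integral_Ioi 1 hint tendsto_id
  have hbd : Tendsto (fun T : ℝ => T⁻¹ * (Real.sin (c * T + γ) / c)) atTop (𝓝 0) := by
    refine tendsto_inv_atTop_zero.zero_mul_isBoundedUnder_le ?_
    refine isBoundedUnder_of ⟨1 / |c|, fun t => ?_⟩
    simp only [Function.comp, norm_div, Real.norm_eq_abs]
    gcongr
    exact Real.abs_sin_le_one _
  refine ⟨_, ((hbd.sub_const (1⁻¹ * (Real.sin (c * 1 + γ) / c))).add hlim).congr' ?_⟩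
  filter_upwards [eventually_ge_atTop 1] with T hT
  have hpos : ∀ t ∈ Set.uIcc 1 T, t ≠ 0 := fun t ht => by
    rw [Set.uIcc_of_le hT] at ht
    exact (lt_of_lt_of_le one_pos ht.1).ne'
  have key := intervalIntegral.integral_mul_deriv_eq_deriv_mul (a := 1) (b := T)
    (u := fun t : ℝ => t⁻¹) (u' := fun t => -(t ^ 2)⁻¹)
    (v := fun t => Real.sin (c * t + γ) / c) (v' := fun t => Real.cos (c * t + γ))
    (fun t ht => hasDerivAt_inv (hpos t ht))
    (fun t _ => by
      have := (((hasDerivAt_id t).const_mul c).add_const γ).sin.div_const c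
      simpa [hc] using this)
    (ContinuousOn.intervalIntegrable
      (ContinuousOn.neg (ContinuousOn.inv₀ (by fun_prop) fun t ht => pow_ne_zero 2 (hpos t ht))))
    (Continuous.intervalIntegrable (by fun_prop) _ _)
  rw [key]
  simp only [neg_mul, intervalIntegral.integral_neg, sub_neg_eq_add, id]

/-- The improper integral in the definition of the kernel converges in every case. -/
theorem exists_tendsto_edgeIntegrand (x₁ : ℤ) (u₁ : ℝ≥0) (x₂ : ℤ) (u₂ : ℝ≥0) (hx : x₂ < x₁) :
    ∃ l : ℝ, Tendsto (fun T : ℝ => ∫ t in (1 : ℝ)..T, edgeIntegrand x₁ u₁ x₂ u₂ t) atTop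
      (𝓝 l) := by
  rcases lt_or_eq_of_le (show x₂ - x₁ ≤ -1 by omega) with hlt | heq
  · have hint : IntegrableOn (edgeIntegrand x₁ u₁ x₂ u₂) (Set.Ioi 1) := by
      have h2 : IntegrableOn (fun t : ℝ => t ^ (x₂ - x₁)) (Set.Ioi 1) := by
        have h3 : ((x₂ - x₁ : ℤ) : ℝ) < -1 := by exact_mod_cast hlt
        refine (integrableOn_Ioi_rpow_of_lt h3 one_pos).congr_fun ?_ measurableSet_Ioi
        intro t _
        exact Real.rpow_intCast t _
      unfold edgeIntegrand
      refine (h2.mul_bdd (c := 1) (by fun_prop) (ae_of_all _ fun t => ?_)).mul_bdd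
        (c := 1) (by fun_prop) (ae_of_all _ fun t => ?_)
      · exact Real.abs_cos_le_one _
      · exact Real.abs_cos_le_one _
    exact ⟨_, intervalIntegral_tendsto_integral_Ioi 1 hint tendsto_id⟩
  · have hodd : ∀ y : ℤ, Odd y → Real.cos (Real.pi / 2 * y) = 0 := by
      rintro y ⟨m, rfl⟩
      refine Real.cos_eq_zero_iff.2 ⟨m, ?_⟩
      push_cast
      ring
    obtain ⟨a, ha⟩ := exists_tendsto_cos_div ((u₁ : ℝ) + u₂) (Real.pi / 2 * (x₁ + x₂ : ℤ))
      (fun _ => hodd _ ⟨x₂, by omega⟩)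
    obtain ⟨b, hb⟩ := exists_tendsto_cos_div ((u₁ : ℝ) - u₂) (Real.pi / 2 * (x₁ - x₂ : ℤ))
      (fun _ => hodd _ ⟨0, by omega⟩)
    refine ⟨2⁻¹ * (a + b), ((ha.add hb).const_mul 2⁻¹).congr' ?_⟩
    filter_upwards [eventually_ge_atTop 1] with T hT
    have hii : ∀ c γ : ℝ, IntervalIntegrable (fun t : ℝ => t⁻¹ * Real.cos (c * t + γ))
        volume 1 T := fun c γ => by
      refine ContinuousOn.intervalIntegrable (ContinuousOn.mul (continuousOn_id.inv₀ ?_)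
        (by fun_prop))
      intro t ht
      rw [Set.uIcc_of_le hT] at ht
      exact (lt_of_lt_of_le one_pos ht.1).ne'
    rw [← intervalIntegral.integral_add (hii _ _) (hii _ _),
      ← intervalIntegral.integral_const_mul]
    refine intervalIntegral.integral_congr fun t _ => ?_
    simp only [edgeIntegrand, heq, zpow_neg_one]
    have e1 : ((u₁ : ℝ) + u₂) * t + Real.pi / 2 * (x₁ + x₂ : ℤ)
        = (t * u₁ + Real.pi / 2 * x₁) + (t * u₂ + Real.pi / 2 * x₂) := by push_cast; ring
    have e2 : ((u₁ : ℝ) - u₂) * t + Real.pi / 2 * (x₁ - x₂ : ℤ)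
        = (t * u₁ + Real.pi / 2 * x₁) - (t * u₂ + Real.pi / 2 * x₂) := by push_cast; ring
    rw [e1, e2, Real.cos_add, Real.cos_sub]
    ring

/-! ### Spatial translations -/

/-- The translation `τ^h : (x, u) ↦ (x + 2 h, u)` of `ℤ × ℝ≥0`, as a homeomorphism. -/
def shift (h : ℤ) : (ℤ × ℝ≥0) ≃ₜ (ℤ × ℝ≥0) :=
  (Homeomorph.addRight (2 * h)).prodCongr (Homeomorph.refl ℝ≥0)

/-- The translated configuration `τ^h X = {(x + 2 h, u) : (x, u) ∈ X}`. -/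
def shiftConfig (h : ℤ) (X : Configuration (ℤ × ℝ≥0)) : Configuration (ℤ × ℝ≥0) where
  points := shift h '' X.points
  finite_inter C hC := by
    have h1 : IsCompact (shift h ⁻¹' C) := (shift h).isCompact_preimage.2 hC
    refine ((X.finite_inter _ h1).image (shift h)).subset ?_
    rintro _ ⟨⟨p, hp, rfl⟩, hpC⟩
    exact ⟨p, ⟨hp, hpC⟩, rfl⟩

/-- `E` belongs to the invariant sigma-algebra: it is an event with `τ^h E = E` for all `h`. -/
def IsInvariantEvent (E : Set (Configuration (ℤ × ℝ≥0))) : Prop :=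
  MeasurableSet E ∧ ∀ h : ℤ, shiftConfig h '' E = E

end EdgeProcess

/-! The law of the process is mixing under translations, and mixing forces invariant events to be
trivial. Three properties of the kernel suffice: it is translation invariant (`edgeKernel_shift`),
bounded (`abs_edgeKernel_le`), and tends to zero when one argument is translated to infinity
(`tendsto_edgeKernel_shift_right`, `tendsto_edgeKernel_shift_left`). Boundedness is delicate only
for `x₂ = x₁ - 1`, where the defining integral need not converge absolutely.

The events "no point in `U`", with `U` open and relatively compact, form a π-system generating the
sigma-algebra (`generateFrom_avoidEvents`). By inclusion-exclusion each has as probability the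
Fredholm series `∑ (-1)^k / k! ∫ det K` over `U` (`IsDeterminantal.measureReal_avoid`). Hadamard's
inequality bounds the `k`-th integral by `(√k M |U|)^k`, which `k!` beats. This justifies the
interchange of sum and expectation, and later the passage to the limit.

For the union of `U` and a far translate of `V`, each determinant is expanded according to which
points lie in which set. The off-diagonal blocks vanish in the limit, so the determinants factor,
and a Cauchy product turns the series into the product of those of `U` and `V` (`tendsto_fredholm`).
A π-λ argument replaces the event of `V` by any event
(`IsDeterminantal.tendsto_avoid_inter_preimage`). For an invariant event the converging sequence is
constant. The event is therefore independent of all avoidance events, hence of itself. -/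

namespace EdgeProcess

/-! ### Hadamard's inequality and summability of Fredholm series -/

/-- Hadamard's inequality in terms of a bound on the entries. -/
theorem abs_det_le_of_abs_le {n : Type*} [Fintype n] [DecidableEq n] (A : Matrix n n ℝ) {M : ℝ}
    (hA : ∀ i j, |A i j| ≤ M) :
    |A.det| ≤ (Real.sqrt (Fintype.card n) * M) ^ Fintype.card n := by
  rcases isEmpty_or_nonempty n with hn | hn
  · simp
  have hM : 0 ≤ M := (abs_nonneg _).trans (hA hn.some hn.some)
  set N := Fintype.card n with hN
  have hN0 : (0 : ℝ) < N := by exact_mod_cast Fintype.card_pos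
  have hpos : (A * A.transpose).PosSemidef := by
    simpa using Matrix.posSemidef_self_mul_conjTranspose A
  have hH := hpos.isHermitian
  have htr : (A * A.transpose).trace ≤ N ^ 2 * M ^ 2 := by
    have : ∀ i j, A i j * A i j ≤ M ^ 2 := fun i j => by
      rw [← sq, ← sq_abs]; gcongr; exact hA i j
    calc (A * A.transpose).trace = ∑ i, ∑ j, A i j * A i j := by
          simp [Matrix.trace, Matrix.mul_apply]
      _ ≤ ∑ i : n, ∑ j : n, M ^ 2 := by gcongr; exact this _ _
      _ = N ^ 2 * M ^ 2 := by simp [hN]; ring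
  have hdet : A.det ^ 2 = ∏ i, hH.eigenvalues i := by
    have := hH.det_eq_prod_eigenvalues
    simp only [Matrix.det_mul, Matrix.det_transpose] at this
    simpa [sq] using this
  have hsum : (A * A.transpose).trace = ∑ i, hH.eigenvalues i := by
    simpa using hH.trace_eq_sum_eigenvalues
  have hnn : ∀ i, 0 ≤ hH.eigenvalues i := hpos.eigenvalues_nonneg
  -- AM-GM for the eigenvalues of `A Aᵀ` gives `det A ^ 2 ≤ (tr (A Aᵀ) / N) ^ N`, and the trace is a
  -- sum of `N ^ 2` squares of entries.
  have amgm := Real.geom_mean_le_arith_mean Finset.univ (fun _ : n => (1 : ℝ)) hH.eigenvalues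
    (fun _ _ => zero_le_one) (by simpa using hN0) (fun i _ => hnn i)
  simp only [Real.rpow_one, one_mul, Finset.sum_const, Finset.card_univ, nsmul_eq_mul, mul_one,
    ← hN, ← hdet, ← hsum] at amgm
  have h1 : A.det ^ 2 ≤ (N * M ^ 2) ^ N := by
    have h2 : ((A.det ^ 2) ^ ((N : ℝ)⁻¹)) ^ N ≤ (N * M ^ 2) ^ N := by
      gcongr
      refine amgm.trans ?_
      rw [div_le_iff₀ hN0]
      nlinarith
    rwa [← Real.rpow_natCast, ← Real.rpow_mul (sq_nonneg _), inv_mul_cancel₀ hN0.ne',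
      Real.rpow_one] at h2
  refine abs_le_of_sq_le_sq ?_ (by positivity)
  rw [← pow_mul, mul_comm _ 2, pow_mul, mul_pow, Real.sq_sqrt hN0.le]
  exact h1

/-- Since `k ^ k / k! ≤ e ^ k`, the square of the term `x` is at most `(e B ^ 2) ^ k / k!`. The
inequality `2 x ≤ 4 ^ k x ^ 2 + 4 ^ (-k)` passes from the square back to `x` at the cost of a
geometric series. -/
theorem summable_sqrt_mul_pow_div_factorial (B : ℝ) :
    Summable fun k : ℕ => (Real.sqrt k * B) ^ k / k.factorial := by
  have key : ∀ k : ℕ, ‖(Real.sqrt k * B) ^ k / k.factorial‖ ≤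
      ((4 * Real.exp 1 * B ^ 2) ^ k / k.factorial + (1 / 4) ^ k) / 2 := by
    intro k
    have hf : (0 : ℝ) < k.factorial := by exact_mod_cast k.factorial_pos
    have hkk : (k : ℝ) ^ k / k.factorial ≤ Real.exp 1 ^ k := by
      rw [← Real.exp_nat_mul, mul_one]
      exact Real.pow_div_factorial_le_exp (k : ℝ) (Nat.cast_nonneg k) k
    have hx2 : ‖(Real.sqrt k * B) ^ k / k.factorial‖ ^ 2 ≤
        (Real.exp 1 * B ^ 2) ^ k / k.factorial := by
      rw [Real.norm_eq_abs, sq_abs, div_pow, ← pow_mul, mul_comm k 2, pow_mul, mul_pow,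
        Real.sq_sqrt (Nat.cast_nonneg k), mul_pow (k : ℝ), mul_pow (Real.exp 1)]
      calc (k : ℝ) ^ k * (B ^ 2) ^ k / (k.factorial : ℝ) ^ 2
          = (k : ℝ) ^ k / k.factorial * ((B ^ 2) ^ k / k.factorial) := by
            rw [div_mul_div_comm, sq (k.factorial : ℝ)]
        _ ≤ Real.exp 1 ^ k * ((B ^ 2) ^ k / k.factorial) := by gcongr
        _ = Real.exp 1 ^ k * (B ^ 2) ^ k / k.factorial := by ring
    set x := ‖(Real.sqrt k * B) ^ k / k.factorial‖
    have h4 : (4 * Real.exp 1 * B ^ 2) ^ k / k.factorial =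
        4 ^ k * ((Real.exp 1 * B ^ 2) ^ k / k.factorial) := by
      rw [mul_assoc, mul_pow]; ring
    have h5 : (4 : ℝ) ^ k * (1 / 4) ^ k = 1 := by rw [← mul_pow]; norm_num
    have h6 : (2 : ℝ) ^ k * 2 ^ k = 4 ^ k := by rw [← mul_pow]; norm_num
    have h7 : (1 / 2 : ℝ) ^ k * (1 / 2) ^ k = (1 / 4) ^ k := by rw [← mul_pow]; norm_num
    have h8 : (2 : ℝ) ^ k * (1 / 2) ^ k = 1 := by rw [← mul_pow]; norm_num
    rw [h4]
    have h9 : (4 : ℝ) ^ k * x ^ 2 ≤ 4 ^ k * ((Real.exp 1 * B ^ 2) ^ k / k.factorial) := by gcongr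
    have h10 := sq_nonneg ((2 : ℝ) ^ k * x - (1 / 2) ^ k)
    have h11 : ((2 : ℝ) ^ k * x - (1 / 2) ^ k) ^ 2 =
      (2 ^ k * 2 ^ k) * x ^ 2 - 2 * (2 ^ k * (1 / 2) ^ k) * x + (1 / 2) ^ k * (1 / 2) ^ k := by ring
    rw [h11, h6, h7, h8] at h10
    linarith
  refine Summable.of_norm_bounded ?_ key
  exact ((Real.summable_pow_div_factorial _).add
    (summable_geometric_of_lt_one (by norm_num) (by norm_num))).div_const 2

/-! ### Factorial moments and avoidance probabilities -/

section

variable {S : Type*} [TopologicalSpace S]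

/-- The same finite index set serves all test functions supported in `C`, so limits and inequalities
can be taken term by term. -/
theorem exists_finset_distinctTuples (k : ℕ) (X : Configuration S) {C : Set S}
    (hC : IsCompact C) :
    ∃ D : Finset (distinctTuples k X), ∀ p, p ∈ D ↔ ∀ i, p.1 i ∈ C := by
  have hfin : {p : distinctTuples k X | ∀ i, p.1 i ∈ C}.Finite := by
    refine Set.Finite.of_finite_image (f := Subtype.val) ?_ Subtype.val_injective.injOn
    refine (Set.Finite.pi' fun _ : Fin k => X.finite_inter C hC).subset ?_
    rintro _ ⟨p, hp, rfl⟩ i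
    exact ⟨p.2.2 i, hp i⟩
  exact ⟨hfin.toFinset, fun p => by simp⟩

theorem tupleSum_eq_sum {k : ℕ} {X : Configuration S} {C : Set S}
    {D : Finset (distinctTuples k X)} (hD : ∀ p, p ∈ D ↔ ∀ i, p.1 i ∈ C)
    {φ : S → ℝ} (hφ : ∀ x, x ∉ C → φ x = 0) :
    tupleSum (fun p : Fin k → S => ∏ i, φ (p i)) X = ∑ p ∈ D, ∏ i, φ (p.1 i) := by
  refine tsum_eq_sum fun p hp => ?_
  rw [hD] at hp
  push Not at hp
  obtain ⟨i, hi⟩ := hp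
  exact Finset.prod_eq_zero (Finset.mem_univ i) (hφ _ hi)

/-- The number of `k`-tuples of distinct points of `X` in `U`. -/
theorem tupleSum_indicator (k : ℕ) (X : Configuration S) {U C : Set S} (hC : IsCompact C)
    (hUC : U ⊆ C) :
    tupleSum (fun p : Fin k → S => ∏ i, U.indicator (fun _ => (1 : ℝ)) (p i)) X =
      ((X.points ∩ U).ncard.descFactorial k : ℕ) := by
  classical
  have hfin : (X.points ∩ U).Finite := (X.finite_inter C hC).subset (by gcongr)
  have := hfin.fintype
  obtain ⟨D, hD⟩ := exists_finset_distinctTuples k X hC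
  rw [tupleSum_eq_sum hD (fun x hx => Set.indicator_of_notMem (fun h => hx (hUC h)) _)]
  have h1 : ∀ p : distinctTuples k X, ∏ i, U.indicator (fun _ => (1 : ℝ)) (p.1 i) =
      if ∀ i, p.1 i ∈ U then 1 else 0 := by
    intro p
    split_ifs with h
    · exact Finset.prod_eq_one fun i _ => Set.indicator_of_mem (h i) _
    · push Not at h
      obtain ⟨i, hi⟩ := h
      exact Finset.prod_eq_zero (Finset.mem_univ i) (Set.indicator_of_notMem hi _)
  simp only [h1]
  rw [Finset.sum_boole]
  congr 1
  have h2 : (X.points ∩ U).ncard = Fintype.card (X.points ∩ U : Set S) := by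
    rw [Set.ncard_eq_toFinset_card', Set.toFinset_card]
  rw [h2]
  have h3 := Fintype.card_embedding_eq (α := Fin k) (β := (X.points ∩ U : Set S))
  rw [Fintype.card_fin] at h3
  rw [← h3, ← Finset.card_univ]
  -- Tuples of distinct points in `U` are the embeddings of `Fin k` into the finite set `X ∩ U`,
  -- which the falling factorial counts.
  refine Finset.card_bij'
    (fun p hp => ⟨fun i => ⟨p.1 i, p.2.2 i, (Finset.mem_filter.1 hp).2 i⟩, fun i j hij =>
      p.2.1 (congrArg Subtype.val hij)⟩)
    (fun e _ => ⟨fun i => (e i).1, fun i j hij => e.injective (Subtype.ext hij),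
      fun i => (e i).2.1⟩)
    (fun _ _ => Finset.mem_univ _) (fun e _ => ?_) (fun _ _ => rfl) (fun _ _ => rfl)
  simp only [Finset.mem_filter, hD]
  exact ⟨fun i => hUC (e i).2.2, fun i => (e i).2.2⟩

end

/-- The integral of the `ι`-point determinant of `K` against the `ι`-th power of `ν`. -/
noncomputable def corrIntegral {S : Type*} [MeasurableSpace S] (K : S → S → ℝ) (ι : Type*)
    [Fintype ι] [DecidableEq ι] (ν : Measure S) : ℝ :=
  ∫ p : ι → S, (Matrix.of fun i j : ι => K (p i) (p j)).det ∂(Measure.pi fun _ => ν)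

section

variable {S : Type*} [MeasurableSpace S]

theorem measurable_det_kernel {ι : Type*} [Fintype ι] [DecidableEq ι]
    {K : S → S → ℝ} (hK : Measurable (Function.uncurry K)) {T : Type*} [MeasurableSpace T]
    {g : ι → T → S} (hg : ∀ i, Measurable (g i)) :
    Measurable fun p : T => (Matrix.of fun i j : ι => K (g i p) (g j p)).det := by
  simp only [Matrix.det_apply, Matrix.of_apply]
  refine Finset.measurable_sum _ fun σ _ => Measurable.const_smul ?_ _
  exact Finset.measurable_prod _ fun i _ => hK.comp ((hg _).prodMk (hg _))

theorem abs_corrIntegral_le {K : S → S → ℝ} {M : ℝ} (hM : ∀ p q, |K p q| ≤ M)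
    (ι : Type*) [Fintype ι] [DecidableEq ι] (ν : Measure S) [IsFiniteMeasure ν] :
    |corrIntegral K ι ν| ≤ (Real.sqrt (Fintype.card ι) * (M * ν.real Set.univ)) ^
      Fintype.card ι := by
  have hdet : ∀ p : ι → S, ‖(Matrix.of fun i j : ι => K (p i) (p j)).det‖ ≤
      (Real.sqrt (Fintype.card ι) * M) ^ Fintype.card ι := fun p =>
    abs_det_le_of_abs_le _ fun i j => hM (p i) (p j)
  refine (norm_integral_le_of_norm_le_const (ae_of_all _ hdet)).trans_eq ?_
  simp only [measureReal_def, Measure.pi_univ, Finset.prod_const, ENNReal.toReal_pow,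
    Finset.card_univ]
  rw [← mul_pow, mul_assoc]

/-- Hadamard's bound uses only the size of the entries, so no symmetry or positivity of the kernel
is needed. -/
theorem summable_corrIntegral {K : S → S → ℝ} {M : ℝ} (hM : ∀ p q, |K p q| ≤ M)
    (ν : Measure S) [IsFiniteMeasure ν] :
    Summable fun k : ℕ => ((-1) ^ k / k.factorial : ℝ) * corrIntegral K (Fin k) ν := by
  refine Summable.of_norm_bounded
    (summable_sqrt_mul_pow_div_factorial (M * ν.real Set.univ)) fun k => ?_
  have h := abs_corrIntegral_le hM (Fin k) ν
  rw [Fintype.card_fin] at h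
  rw [norm_mul, norm_div, norm_pow, norm_neg, norm_one, one_pow, Real.norm_eq_abs,
    Real.norm_eq_abs, Nat.abs_cast, one_div, inv_mul_eq_div]
  gcongr

end

section

variable {S : Type*} [TopologicalSpace S] [MeasurableSpace S]

theorem measurable_encard_inter {B : Set S} (hB : MeasurableSet B) :
    Measurable fun X : Configuration S => (X.points ∩ B).encard := by
  refine Measurable.mono (comap_measurable _) (le_iSup (fun B : {B : Set S // MeasurableSet B} =>
    MeasurableSpace.comap (fun X : Configuration S => (X.points ∩ B.1).encard) ⊤) ⟨B, hB⟩) le_top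

theorem measurableSet_avoid {B : Set S} (hB : MeasurableSet B) :
    MeasurableSet {X : Configuration S | X.points ∩ B = ∅} := by
  have : {X : Configuration S | X.points ∩ B = ∅} =
      (fun X : Configuration S => (X.points ∩ B).encard) ⁻¹' {0} := by
    ext X; simp
  rw [this]
  exact measurable_encard_inter hB (measurableSet_singleton _)

variable [LocallyCompactSpace S] [T2Space S] [HasOuterApproxClosed S] [SecondCountableTopology S]
  [BorelSpace S] {μ : Measure S} [SigmaFinite μ] [IsFiniteMeasureOnCompacts μ]
  {K : S → S → ℝ} {Ω : Type*} [MeasurableSpace Ω] {P : Measure Ω} {X : Ω → Configuration S}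

/-- The factorial moments of the number of points in a relatively compact open set. -/
theorem IsDeterminantal.factorialMoment (hX : IsDeterminantal K μ P X)
    (hK : Measurable (Function.uncurry K)) {M : ℝ} (hM : ∀ p q, |K p q| ≤ M)
    {U C : Set S} (hU : IsOpen U) (hC : IsCompact C) (hUC : U ⊆ C) (k : ℕ) :
    Integrable (fun ω => ((((X ω).points ∩ U).ncard.descFactorial k : ℕ) : ℝ)) P ∧
      ∫ ω, ((((X ω).points ∩ U).ncard.descFactorial k : ℕ) : ℝ) ∂P =
        corrIntegral K (Fin k) (μ.restrict U) := by
  obtain ⟨ψ, hψ1, hψc, -, hψ⟩ := exists_continuousMap_one_of_isCompact_subset_isOpen hC isOpen_univ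
    (Set.subset_univ C)
  -- Continuous approximations of the indicator of `U` that vanish off `U`. All are dominated by the
  -- single compactly supported `ψ`, whose tuple sum is integrable by hypothesis.
  set φ : ℕ → S → ℝ := fun n x => 1 - (hU.isClosed_compl.apprSeq n x : ℝ) with hφdef
  have hφc : ∀ n, Continuous (φ n) := fun n => by fun_prop
  have hφ0 : ∀ n x, 0 ≤ φ n x := fun n x => by
    have := HasOuterApproxClosed.apprSeq_apply_le_one hU.isClosed_compl n x
    have : (hU.isClosed_compl.apprSeq n x : ℝ) ≤ 1 := by exact_mod_cast this
    simp only [hφdef]; linarith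
  have hφ1 : ∀ n x, φ n x ≤ 1 := fun n x => by simp [hφdef]
  have hφU : ∀ n x, x ∉ U → φ n x = 0 := fun n x hx => by
    simp [hφdef, HasOuterApproxClosed.apprSeq_apply_eq_one hU.isClosed_compl n hx]
  have hφlim : ∀ x, Tendsto (fun n => φ n x) atTop (𝓝 (U.indicator (fun _ => (1 : ℝ)) x)) := by
    intro x
    have h1 := (tendsto_pi_nhds.1
      (HasOuterApproxClosed.tendsto_apprSeq hU.isClosed_compl)) x
    have h2 : Tendsto (fun n => (hU.isClosed_compl.apprSeq n x : ℝ)) atTop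
      (𝓝 (((Uᶜ).indicator (fun _ => (1 : ℝ≥0)) x : ℝ≥0) : ℝ)) :=
      (NNReal.continuous_coe.tendsto _).comp h1
    have h3 := h2.const_sub 1
    convert h3 using 2
    by_cases hx : x ∈ U <;> simp [hx]
  have hφψ : ∀ n x, φ n x ≤ ψ x := fun n x => by
    by_cases hx : x ∈ U
    · rw [hψ1 (hUC hx)]; exact hφ1 n x
    · rw [hφU n x hx]; exact (hψ x).1
  have hφC : ∀ n x, x ∉ tsupport ψ → φ n x = 0 := fun n x hx =>
    le_antisymm ((hφψ n x).trans_eq (image_eq_zero_of_notMem_tsupport hx)) (hφ0 n x)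
  have hUψ : U ⊆ tsupport ψ := fun x hx => subset_tsupport _ (by
    rw [Function.mem_support, hψ1 (hUC hx)]; exact one_ne_zero)
  have hfc : ∀ g : S → ℝ, Continuous g → Continuous fun p : Fin k → S => ∏ i, g (p i) :=
    fun g hg => by fun_prop
  have hfs : ∀ g : S → ℝ, (∀ x, x ∉ tsupport ψ → g x = 0) →
      HasCompactSupport fun p : Fin k → S => ∏ i, g (p i) := fun g hg => by
    refine HasCompactSupport.intro (isCompact_univ_pi fun _ : Fin k => hψc) fun p hp => ?_
    simp only [Set.mem_univ_pi, not_forall] at hp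
    obtain ⟨i, hi⟩ := hp
    exact Finset.prod_eq_zero (Finset.mem_univ i) (hg _ hi)
  have hψ0 : ∀ x, x ∉ tsupport ψ → ψ x = 0 := fun x => image_eq_zero_of_notMem_tsupport
  have hdom := hX.integrable k _ (hfc ψ ψ.continuous) (hfs ψ hψ0)
  have hmeas : ∀ n, AEStronglyMeasurable
      (fun ω => tupleSum (fun p : Fin k → S => ∏ i, φ n (p i)) (X ω)) P := fun n =>
    (hX.integrable k _ (hfc _ (hφc n)) (hfs _ (hφC n))).aestronglyMeasurable
  have hlim : ∀ ω, Tendsto (fun n => tupleSum (fun p : Fin k → S => ∏ i, φ n (p i)) (X ω)) atTop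
      (𝓝 ((((X ω).points ∩ U).ncard.descFactorial k : ℕ) : ℝ)) := by
    intro ω
    obtain ⟨D, hD⟩ := exists_finset_distinctTuples k (X ω) hψc
    rw [← tupleSum_indicator k (X ω) hψc hUψ, tupleSum_eq_sum hD fun x hx =>
      Set.indicator_of_notMem (fun h => hx (hUψ h)) _]
    simp only [fun n => tupleSum_eq_sum (k := k) hD (hφC n)]
    exact tendsto_finsetSum _ fun p _ => tendsto_finsetProd _ fun i _ => hφlim _
  have hbd : ∀ n ω, ‖tupleSum (fun p : Fin k → S => ∏ i, φ n (p i)) (X ω)‖ ≤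
      tupleSum (fun p : Fin k → S => ∏ i, ψ (p i)) (X ω) := by
    intro n ω
    obtain ⟨D, hD⟩ := exists_finset_distinctTuples k (X ω) hψc
    rw [tupleSum_eq_sum hD (hφC n), tupleSum_eq_sum hD hψ0, Real.norm_of_nonneg
      (Finset.sum_nonneg fun p _ => Finset.prod_nonneg fun i _ => hφ0 _ _)]
    exact Finset.sum_le_sum fun p _ => Finset.prod_le_prod (fun i _ => hφ0 _ _)
      fun i _ => hφψ _ _
  have hlhs := tendsto_integral_of_dominated_convergence _ hmeas hdom
    (fun n => ae_of_all _ (hbd n)) (ae_of_all _ hlim)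
  refine ⟨?_, tendsto_nhds_unique hlhs ?_⟩
  · refine hdom.mono' (aestronglyMeasurable_of_tendsto_ae atTop hmeas (ae_of_all _ hlim))
      (ae_of_all _ fun ω => ?_)
    exact le_of_tendsto (hlim ω).norm (Eventually.of_forall fun n => hbd n ω)
  have : IsFiniteMeasure (μ.restrict U) :=
    isFiniteMeasure_restrict.2 ((measure_mono hUC).trans_lt hC.measure_lt_top).ne
  -- All `φ n` vanish off `U`, so the integral lives on a finite measure, where the constant
  -- Hadamard bound is integrable.
  have hexp : ∀ n, ∫ ω, tupleSum (fun p : Fin k → S => ∏ i, φ n (p i)) (X ω) ∂P =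
      ∫ p, (Matrix.of fun i j : Fin k => K (p i) (p j)).det * ∏ i, φ n (p i)
        ∂(Measure.pi fun _ => μ.restrict U) := by
    intro n
    rw [hX.expectation k _ (hfc _ (hφc n)) (hfs _ (hφC n)), ← Measure.restrict_pi_pi,
      setIntegral_eq_integral_of_forall_compl_eq_zero]
    intro p hp
    simp only [Set.mem_univ_pi, not_forall] at hp
    obtain ⟨i, hi⟩ := hp
    exact mul_eq_zero_of_right _ (Finset.prod_eq_zero (Finset.mem_univ i) (hφU n _ hi))
  simp only [hexp]
  refine tendsto_integral_of_dominated_convergence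
    (fun _ => (Real.sqrt (Fintype.card (Fin k)) * M) ^ Fintype.card (Fin k)) (fun n => ?_)
    (integrable_const _) (fun n => ae_of_all _ fun p => ?_) ?_
  · refine AEStronglyMeasurable.mul ?_ (hfc _ (hφc n)).aestronglyMeasurable
    exact (measurable_det_kernel hK fun i => measurable_pi_apply i).aestronglyMeasurable
  · rw [norm_mul, ← mul_one ((_ : ℝ) ^ _)]
    have h1 := abs_det_le_of_abs_le (Matrix.of fun i j : Fin k => K (p i) (p j))
      fun i j => hM (p i) (p j)
    refine mul_le_mul h1 ?_ (norm_nonneg _) ((abs_nonneg _).trans h1)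
    rw [Real.norm_of_nonneg (Finset.prod_nonneg fun i _ => hφ0 _ _)]
    exact Finset.prod_le_one (fun i _ => hφ0 _ _) fun i _ => hφ1 _ _
  · have hae : ∀ᵐ p ∂(Measure.pi fun _ : Fin k => μ.restrict U), ∀ i, p i ∈ U := by
      rw [← Measure.restrict_pi_pi]
      filter_upwards [ae_restrict_mem (MeasurableSet.univ_pi fun _ => hU.measurableSet)] with p hp i
      exact hp i trivial
    filter_upwards [hae] with p hp
    have h1 : Tendsto (fun n => ∏ i, φ n (p i)) atTop (𝓝 (∏ i : Fin k, (1 : ℝ))) :=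
      tendsto_finsetProd _ fun i _ => by simpa [hp i] using hφlim (p i)
    simpa using h1.const_mul _

/-- The avoidance probability of a relatively compact open set is a Fredholm series. -/
theorem IsDeterminantal.measureReal_avoid [IsProbabilityMeasure P] (hX : IsDeterminantal K μ P X)
    (hK : Measurable (Function.uncurry K)) {M : ℝ} (hM : ∀ p q, |K p q| ≤ M)
    {U C : Set S} (hU : IsOpen U) (hC : IsCompact C) (hUC : U ⊆ C) :
    P.real {ω | (X ω).points ∩ U = ∅} =
      ∑' k : ℕ, ((-1) ^ k / k.factorial : ℝ) * corrIntegral K (Fin k) (μ.restrict U) := by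
  have : IsFiniteMeasure (μ.restrict U) :=
    isFiniteMeasure_restrict.2 ((measure_mono hUC).trans_lt hC.measure_lt_top).ne
  set N : Ω → ℕ := fun ω => ((X ω).points ∩ U).ncard with hN
  have hfm := hX.factorialMoment hK hM hU hC hUC
  set F : ℕ → Ω → ℝ := fun k ω =>
    ((-1) ^ k / k.factorial : ℝ) * (((N ω).descFactorial k : ℕ) : ℝ) with hF
  have hint : ∀ k, ∫ ω, F k ω ∂P =
      ((-1) ^ k / k.factorial : ℝ) * corrIntegral K (Fin k) (μ.restrict U) := fun k => by
    rw [← (hfm k).2, ← integral_const_mul]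
  -- For fixed `k` the sign of `F k` does not depend on `ω`, so no cancellation occurs and the norms
  -- of the integrals control the integrals of the norms.
  have hnorm : ∀ k, ∫ ω, ‖F k ω‖ ∂P =
      ‖((-1) ^ k / k.factorial : ℝ) * corrIntegral K (Fin k) (μ.restrict U)‖ := fun k => by
    have h0 : 0 ≤ corrIntegral K (Fin k) (μ.restrict U) := by
      rw [← (hfm k).2]; exact integral_nonneg fun ω => Nat.cast_nonneg _
    simp only [hF, norm_mul]
    rw [integral_const_mul, Real.norm_of_nonneg h0, ← (hfm k).2]
    simp [hN]
  have hsum : HasSum (fun k => ∫ ω, F k ω ∂P) (∫ ω, ∑' k, F k ω ∂P) :=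
    hasSum_integral_of_summable_integral_norm (fun k => (hfm k).1.const_mul _)
    (show Summable fun k => ∫ ω, ‖F k ω‖ ∂P by
      simp only [hnorm]; exact (summable_corrIntegral hM _).norm)
  -- Inclusion-exclusion: `∑ (-1)^k (N choose k)` is `1` if `N = 0` and `0` otherwise.
  have hpt : ∀ ω, ∑' k, F k ω = {ω | (X ω).points ∩ U = ∅}.indicator (fun _ => (1 : ℝ)) ω := by
    intro ω
    rw [tsum_eq_sum (s := Finset.range (N ω + 1))]
    · have h1 : ∀ k, F k ω = (((-1) ^ k * (N ω).choose k : ℤ) : ℝ) := fun k => by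
        have : (k.factorial : ℝ) ≠ 0 := by exact_mod_cast k.factorial_ne_zero
        simp only [hF, Nat.descFactorial_eq_factorial_mul_choose]
        push_cast
        field_simp
      simp only [h1]
      rw [← Int.cast_sum, Int.alternating_sum_range_choose]
      have hfin : ((X ω).points ∩ U).Finite := ((X ω).finite_inter C hC).subset (by gcongr)
      have h2 : N ω = 0 ↔ (X ω).points ∩ U = ∅ := Set.ncard_eq_zero hfin
      by_cases h : N ω = 0
      · simp [h, h2.1 h]
      · simp [h, h2.not.1 h]
    · intro k hk
      simp only [Finset.mem_range, not_lt] at hk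
      simp [hF, Nat.descFactorial_of_lt (show N ω < k by omega)]
  have hmeas : MeasurableSet {ω | (X ω).points ∩ U = ∅} :=
    hX.measurable (measurableSet_avoid hU.measurableSet)
  simp only [hint] at hsum
  rw [hsum.tsum_eq]
  rw [integral_congr_ae (ae_of_all P hpt), integral_indicator hmeas]
  simp

end

/-! ### Asymptotic factorization of Fredholm series -/

section

variable {S : Type*} [MeasurableSpace S]

/-- Splitting a determinant into blocks produces subtypes as index sets; only their cardinality
matters. -/
theorem corrIntegral_congr (K : S → S → ℝ) {ι κ : Type*} [Fintype ι] [DecidableEq ι] [Fintype κ]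
    [DecidableEq κ] (h : Fintype.card ι = Fintype.card κ) (ν : Measure S) [SigmaFinite ν] :
    corrIntegral K ι ν = corrIntegral K κ ν := by
  let e : κ ≃ ι := (Fintype.equivOfCardEq h).symm
  have h1 := (measurePreserving_piCongrLeft (fun _ : ι => ν) e).integral_comp'
    (fun p : ι → S => (Matrix.of fun i j : ι => K (p i) (p j)).det)
  rw [corrIntegral, ← h1, corrIntegral]
  refine integral_congr_ae (ae_of_all _ fun p => ?_)
  change Matrix.det _ = Matrix.det _
  rw [← Matrix.det_submatrix_equiv_self e]
  congr 1
  ext i j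
  simp [MeasurableEquiv.coe_piCongrLeft]

/-- Expansion of a power of a sum of two measures. -/
theorem pi_add_eq_sum {ι : Type*} [Fintype ι] [DecidableEq ι] (ν₁ ν₂ : Measure S)
    [IsFiniteMeasure ν₁] [IsFiniteMeasure ν₂] :
    Measure.pi (fun _ : ι => ν₁ + ν₂) =
      ∑ s ∈ (Finset.univ : Finset ι).powerset,
        Measure.pi (fun i => if i ∈ s then ν₁ else ν₂) := by
  have : ∀ (s : Finset ι) (i : ι), IsFiniteMeasure (if i ∈ s then ν₁ else ν₂) := fun s i => by
    split_ifs <;> infer_instance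
  refine Measure.pi_eq fun t ht => ?_
  rw [Measure.finsetSum_apply]
  simp only [Measure.pi_pi, Measure.add_apply]
  rw [Finset.prod_add]
  refine Finset.sum_congr rfl fun s hs => ?_
  rw [← Finset.prod_sdiff (Finset.subset_univ s), mul_comm]
  congr 1
  · exact Finset.prod_congr rfl fun i hi => by rw [if_pos hi]
  · exact Finset.prod_congr rfl fun i hi => by rw [if_neg (Finset.mem_sdiff.1 hi).2]

variable {K : S → S → ℝ} {M : ℝ}

/-- The determinant of a block diagonal kernel integrates to a product. -/
theorem integral_det_block {ι : Type*} [Fintype ι] [DecidableEq ι] (b : ι → Prop) [DecidablePred b]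
    (ν₁ ν₂ : Measure S) [IsFiniteMeasure ν₁] [IsFiniteMeasure ν₂] :
    ∫ p : ι → S, (Matrix.of fun i j : ι => if (b i ↔ b j) then K (p i) (p j) else 0).det
        ∂(Measure.pi fun i => if b i then ν₁ else ν₂) =
      corrIntegral K (Fin (Finset.univ.filter b).card) ν₁ *
        corrIntegral K (Fin (Finset.univ.filter fun i => ¬ b i).card) ν₂ := by
  set m : ι → Measure S := fun i => if b i then ν₁ else ν₂ with hm
  have : ∀ i : ι, IsFiniteMeasure (m i) := fun i => by
    simp only [hm]; split_ifs <;> infer_instance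
  have h1 : ∀ p : ι → S,
      (Matrix.of fun i j : ι => if (b i ↔ b j) then K (p i) (p j) else 0).det =
      (Matrix.of fun i j : {i // b i} => K (p i) (p j)).det *
      (Matrix.of fun i j : {i // ¬ b i} => K (p i) (p j)).det := by
    intro p
    rw [Matrix.twoBlockTriangular_det _ b]
    · congr 2
      · ext i j; simp [Matrix.toSquareBlockProp, i.2, j.2]
      · ext i j; simp [Matrix.toSquareBlockProp, i.2, j.2]
    · intro i hi j hj
      simp [hi, hj]
  simp only [h1]
  have h2 := (measurePreserving_piEquivPiSubtypeProd m b).integral_comp'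
    (fun q : ({i // b i} → S) × ({i // ¬ b i} → S) =>
      (Matrix.of fun i j : {i // b i} => K (q.1 i) (q.1 j)).det *
      (Matrix.of fun i j : {i // ¬ b i} => K (q.2 i) (q.2 j)).det)
  refine h2.trans ?_
  rw [integral_prod_mul (fun q : {i // b i} → S => (Matrix.of fun i j => K (q i) (q j)).det)
    (fun q : {i // ¬ b i} → S => (Matrix.of fun i j => K (q i) (q j)).det)]
  have e1 : (fun i : {i // b i} => m i) = fun _ => ν₁ := by
    ext1 i; exact if_pos i.2
  have e2 : (fun i : {i // ¬ b i} => m i) = fun _ => ν₂ := by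
    ext1 i; exact if_neg i.2
  rw [e1, e2, ← corrIntegral_congr K (ι := {i // b i}) (by simp [Fintype.card_subtype]) ν₁,
    ← corrIntegral_congr K (ι := {i // ¬ b i})
      (by rw [Fintype.card_subtype, Fintype.card_fin]) ν₂, corrIntegral, corrIntegral]

theorem integrable_det {ι : Type*} [Fintype ι] [DecidableEq ι]
    (hK : Measurable (Function.uncurry K)) (hM : ∀ p q, |K p q| ≤ M) (m : Measure (ι → S))
    [IsFiniteMeasure m] :
    Integrable (fun p : ι → S => (Matrix.of fun i j : ι => K (p i) (p j)).det) m :=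
  Integrable.of_bound (measurable_det_kernel hK fun i => measurable_pi_apply i).aestronglyMeasurable
    _ (ae_of_all _ fun p => abs_det_le_of_abs_le (Matrix.of fun i j : ι => K (p i) (p j))
      fun i j => hM (p i) (p j))

/-- Expanding the power of the measure assigns each point to `ν₁` or to the moving part. Pulling
back by `g n` gives fixed measures and a moving integrand. Its diagonal blocks are unchanged by
invariance and its off-diagonal entries tend to zero, so the block determinant is the limit, with
Hadamard's bound as dominating constant. -/
theorem tendsto_corrIntegral (hK : Measurable (Function.uncurry K)) (hM : ∀ p q, |K p q| ≤ M)
    {g : ℕ → S → S} (hg : ∀ n, Measurable (g n)) (hinv : ∀ n p q, K (g n p) (g n q) = K p q)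
    (hright : ∀ p q, Tendsto (fun n => K p (g n q)) atTop (𝓝 0))
    (hleft : ∀ p q, Tendsto (fun n => K (g n p) q) atTop (𝓝 0))
    (ι : Type*) [Fintype ι] [DecidableEq ι] (ν₁ ν₂ : Measure S)
    [IsFiniteMeasure ν₁] [IsFiniteMeasure ν₂] :
    Tendsto (fun n => corrIntegral K ι (ν₁ + ν₂.map (g n))) atTop
      (𝓝 (∑ s ∈ (Finset.univ : Finset ι).powerset,
        corrIntegral K (Fin s.card) ν₁ * corrIntegral K (Fin (Fintype.card ι - s.card)) ν₂)) := by
  have hfin : ∀ (n : ℕ) (s : Finset ι) (i : ι),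
      IsFiniteMeasure (if i ∈ s then ν₁ else ν₂.map (g n)) := fun n s i => by
    split_ifs <;> infer_instance
  have hfin' : ∀ (s : Finset ι) (i : ι), IsFiniteMeasure (if i ∈ s then ν₁ else ν₂) :=
    fun s i => by split_ifs <;> infer_instance
  have h1 : ∀ n, corrIntegral K ι (ν₁ + ν₂.map (g n)) =
      ∑ s ∈ (Finset.univ : Finset ι).powerset,
        ∫ p : ι → S, (Matrix.of fun i j : ι => K (p i) (p j)).det
          ∂(Measure.pi fun i => if i ∈ s then ν₁ else ν₂.map (g n)) := by
    intro n
    rw [corrIntegral, pi_add_eq_sum, integral_finsetSum_measure fun s _ => integrable_det hK hM _]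
  simp only [h1]
  refine tendsto_finsetSum _ fun s _ => ?_
  let G : ℕ → ι → S → S := fun n i => if i ∈ s then id else g n
  have hGm : ∀ n i, Measurable (G n i) := fun n i => by
    simp only [G]; split_ifs
    exacts [measurable_id, hg n]
  have hGp : ∀ n, MeasurePreserving (fun (p : ι → S) i => G n i (p i))
      (Measure.pi fun i => if i ∈ s then ν₁ else ν₂)
      (Measure.pi fun i => if i ∈ s then ν₁ else ν₂.map (g n)) := fun n => by
    refine measurePreserving_pi _ _ fun i => ?_
    by_cases hi : i ∈ s
    · simpa only [G, if_pos hi] using MeasurePreserving.id ν₁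
    · simpa only [G, if_neg hi] using (hg n).measurePreserving ν₂
  have h2 : ∀ n, ∫ p : ι → S, (Matrix.of fun i j : ι => K (p i) (p j)).det
        ∂(Measure.pi fun i => if i ∈ s then ν₁ else ν₂.map (g n)) =
      ∫ p : ι → S, (Matrix.of fun i j : ι => K (G n i (p i)) (G n j (p j))).det
        ∂(Measure.pi fun i => if i ∈ s then ν₁ else ν₂) := by
    intro n
    rw [← (hGp n).map_eq, integral_map (hGp n).aemeasurable]
    exact (measurable_det_kernel hK fun i => measurable_pi_apply i).aestronglyMeasurable
  simp only [h2]
  have hblock := integral_det_block (K := K) (· ∈ s) ν₁ ν₂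
  have hs : Finset.univ.filter (· ∈ s) = s := by ext; simp
  have hsc : (Finset.univ.filter (· ∉ s)).card = Fintype.card ι - s.card := by
    rw [← Finset.card_compl]; congr 1; ext; simp
  rw [hs, hsc] at hblock
  rw [← hblock]
  refine tendsto_integral_of_dominated_convergence
    (fun _ => (Real.sqrt (Fintype.card ι) * M) ^ Fintype.card ι) (fun n => ?_)
    (integrable_const _) (fun n => ae_of_all _ fun p => ?_) (ae_of_all _ fun p => ?_)
  · exact (measurable_det_kernel hK fun i =>
      (hGm n i).comp (measurable_pi_apply i)).aestronglyMeasurable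
  · exact abs_det_le_of_abs_le (Matrix.of fun i j : ι => K (G n i (p i)) (G n j (p j)))
      fun i j => hM _ _
  · have hcont : Continuous fun A : Matrix ι ι ℝ => A.det := continuous_id.matrix_det
    refine (hcont.tendsto _).comp (tendsto_pi_nhds.2 fun i => tendsto_pi_nhds.2 fun j => ?_)
    simp only [Matrix.of_apply]
    by_cases hi : i ∈ s <;> by_cases hj : j ∈ s
    · simp [G, hi, hj]
    · simpa [G, hi, hj] using hright _ _
    · simpa [G, hi, hj] using hleft _ _
    · simp [G, hi, hj, hinv]

/-- The Fredholm series `∑ (-1)^k / k! ∫ det K`. -/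
noncomputable def fredholm (K : S → S → ℝ) (ν : Measure S) : ℝ :=
  ∑' k : ℕ, ((-1) ^ k / k.factorial : ℝ) * corrIntegral K (Fin k) ν

/-- This is the Cauchy product: the `k choose a` subsets of size `a` turn `1 / k!` into `1 / (a! (k
- a)!)`. -/
theorem fredholm_mul (hM : ∀ p q, |K p q| ≤ M) (ν₁ ν₂ : Measure S) [IsFiniteMeasure ν₁]
    [IsFiniteMeasure ν₂] :
    fredholm K ν₁ * fredholm K ν₂ = ∑' k : ℕ, ((-1) ^ k / k.factorial : ℝ) *
      ∑ s ∈ (Finset.univ : Finset (Fin k)).powerset,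
        corrIntegral K (Fin s.card) ν₁ * corrIntegral K (Fin (k - s.card)) ν₂ := by
  rw [fredholm, fredholm, tsum_mul_tsum_eq_tsum_sum_antidiagonal_of_summable_norm
    (summable_corrIntegral hM ν₁).norm (summable_corrIntegral hM ν₂).norm]
  congr 1
  ext k
  rw [Finset.sum_powerset_apply_card
    (fun a => corrIntegral K (Fin a) ν₁ * corrIntegral K (Fin (k - a)) ν₂),
    Finset.card_univ, Fintype.card_fin, Finset.mul_sum,
    Finset.Nat.sum_antidiagonal_eq_sum_range_succ_mk]
  refine Finset.sum_congr rfl fun a ha => ?_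
  have hak : a ≤ k := Nat.lt_succ_iff.1 (Finset.mem_range.1 ha)
  have hc : ((k.choose a : ℕ) : ℝ) = k.factorial / (a.factorial * (k - a).factorial) :=
    Nat.cast_choose ℝ hak
  have hp : (-1 : ℝ) ^ k = (-1) ^ a * (-1) ^ (k - a) := by
    rw [← pow_add, Nat.add_sub_cancel' hak]
  have f1 : (k.factorial : ℝ) ≠ 0 := by exact_mod_cast k.factorial_ne_zero
  have f2 : (a.factorial : ℝ) ≠ 0 := by exact_mod_cast a.factorial_ne_zero
  have f3 : ((k - a).factorial : ℝ) ≠ 0 := by exact_mod_cast (k - a).factorial_ne_zero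
  rw [nsmul_eq_mul, hc, hp]
  field_simp

/-- Fredholm series decouple when the two parts of the measure move apart. -/
theorem tendsto_fredholm (hK : Measurable (Function.uncurry K)) (hM : ∀ p q, |K p q| ≤ M)
    {g : ℕ → S → S} (hg : ∀ n, Measurable (g n)) (hinv : ∀ n p q, K (g n p) (g n q) = K p q)
    (hright : ∀ p q, Tendsto (fun n => K p (g n q)) atTop (𝓝 0))
    (hleft : ∀ p q, Tendsto (fun n => K (g n p) q) atTop (𝓝 0))
    (ν₁ ν₂ : Measure S) [IsFiniteMeasure ν₁] [IsFiniteMeasure ν₂] :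
    Tendsto (fun n => fredholm K (ν₁ + ν₂.map (g n))) atTop
      (𝓝 (fredholm K ν₁ * fredholm K ν₂)) := by
  rw [fredholm_mul hM]
  refine tendsto_tsum_of_dominated_convergence
    (summable_sqrt_mul_pow_div_factorial (M * (ν₁.real Set.univ + ν₂.real Set.univ)))
    (fun k => by
      have := tendsto_corrIntegral hK hM hg hinv hright hleft (Fin k) ν₁ ν₂
      rw [Fintype.card_fin] at this
      exact this.const_mul _)
    (Eventually.of_forall fun n k => ?_)
  have h := abs_corrIntegral_le hM (Fin k) (ν₁ + ν₂.map (g n))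
  -- The total mass does not depend on `n`, so the Hadamard bound is uniform.
  have hmass : (ν₁ + ν₂.map (g n)).real Set.univ = ν₁.real Set.univ + ν₂.real Set.univ := by
    rw [measureReal_add_apply, map_measureReal_apply (hg n) MeasurableSet.univ, Set.preimage_univ]
  rw [Fintype.card_fin, hmass] at h
  rw [norm_mul, norm_div, norm_pow, norm_neg, norm_one, one_pow, Real.norm_eq_abs,
    Real.norm_eq_abs, Nat.abs_cast, one_div, inv_mul_eq_div]
  gcongr

/-- Fredholm series of an invariant kernel are invariant. -/
theorem fredholm_map {g : S → S} (hK : Measurable (Function.uncurry K)) (hg : Measurable g)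
    (hinv : ∀ p q, K (g p) (g q) = K p q) (ν : Measure S) [IsFiniteMeasure ν] :
    fredholm K (ν.map g) = fredholm K ν := by
  have : ∀ k : ℕ, corrIntegral K (Fin k) (ν.map g) = corrIntegral K (Fin k) ν := fun k => by
    have h := measurePreserving_pi (fun _ : Fin k => ν) (fun _ => ν.map g)
      (fun _ => hg.measurePreserving ν)
    rw [corrIntegral, ← h.map_eq, integral_map h.aemeasurable, corrIntegral]
    · simp only [hinv]
    · exact (measurable_det_kernel hK fun i => measurable_pi_apply i).aestronglyMeasurable
  simp only [fredholm, this]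

end

/-! ### Avoidance events generate the sigma-algebra -/

/-- As a sum over a finite set not depending on `A`, the count is visibly additive in `A`. -/
theorem ncard_inter_eq_sum_indicator {S : Type*} {X W : Set S} (hfin : (X ∩ W).Finite) (A : Set S) :
    ((X ∩ (A ∩ W)).ncard : ℝ) = ∑ x ∈ hfin.toFinset, A.indicator (fun _ => (1 : ℝ)) x := by
  classical
  have : X ∩ (A ∩ W) = (hfin.toFinset.filter (· ∈ A) : Finset S) := by
    ext x; simp; tauto
  rw [this, Set.ncard_coe_finset, Finset.card_filter]
  push_cast
  exact Finset.sum_congr rfl fun x _ => by by_cases h : x ∈ A <;> simp [h]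

/-- The events that a relatively compact open set contains no point. -/
def avoidEvents (S : Type*) [TopologicalSpace S] : Set (Set (Configuration S)) :=
  {A | ∃ U : Set S, IsOpen U ∧ (∃ C, IsCompact C ∧ U ⊆ C) ∧
    A = {X : Configuration S | X.points ∩ U = ∅}}

theorem isPiSystem_avoidEvents (S : Type*) [TopologicalSpace S] : IsPiSystem (avoidEvents S) := by
  rintro _ ⟨U, hU, ⟨C, hC, hUC⟩, rfl⟩ _ ⟨V, hV, ⟨D, hD, hVD⟩, rfl⟩ -
  refine ⟨U ∪ V, hU.union hV, ⟨C ∪ D, hC.union hD, Set.union_subset_union hUC hVD⟩, ?_⟩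
  ext X
  simp [Set.inter_union_distrib_left, Set.union_empty_iff]

/-- Finitely many points of a Hausdorff space have disjoint neighbourhoods, which may be taken in a
countable basis. The count is thus expressed by countably many avoidance events. -/
theorem le_ncard_inter_iff {S : Type*} [TopologicalSpace S] [T2Space S] [SecondCountableTopology S]
    (X : Configuration S)
    {U C : Set S} (hU : IsOpen U) (hC : IsCompact C) (hUC : U ⊆ C) (n : ℕ) :
    n ≤ (X.points ∩ U).ncard ↔
      ∃ f : Fin n → TopologicalSpace.countableBasis S, (∀ i, (f i : Set S) ⊆ U) ∧
        (∀ i j, i ≠ j → Disjoint (f i : Set S) (f j)) ∧ ∀ i, X.points ∩ f i ≠ ∅ := by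
  have hfin : (X.points ∩ U).Finite := (X.finite_inter C hC).subset (by gcongr)
  have hB := TopologicalSpace.isBasis_countableBasis S
  constructor
  · intro h
    rw [Set.ncard_eq_toFinset_card _ hfin] at h
    obtain ⟨t, htsub, htcard⟩ := Finset.exists_subset_card_eq h
    obtain ⟨V, hV, hVd⟩ := hfin.t2_separation
    let e : Fin n ≃ t := (t.equivFinOfCardEq htcard).symm
    have he : ∀ i, (e i : S) ∈ X.points ∩ U := fun i => hfin.mem_toFinset.1 (htsub (e i).2)
    have hex : ∀ i, ∃ v ∈ TopologicalSpace.countableBasis S, (e i : S) ∈ v ∧ v ⊆ V (e i) ∩ U :=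
      fun i => hB.exists_subset_of_mem_open ⟨(hV _).1, (he i).2⟩ ((hV _).2.inter hU)
    choose v hv hev hvV using hex
    refine ⟨fun i => ⟨v i, hv i⟩, fun i => (hvV i).trans Set.inter_subset_right,
      fun i j hij => ?_, fun i => ?_⟩
    · have hne : (e i : S) ≠ e j := fun h => hij (e.injective (Subtype.ext h))
      exact (hVd (he i) (he j) hne).mono ((hvV i).trans Set.inter_subset_left)
        ((hvV j).trans Set.inter_subset_left)
    · exact Set.Nonempty.ne_empty ⟨e i, (he i).1, hev i⟩
  · rintro ⟨f, hfU, hfd, hfX⟩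
    choose x hx using fun i => Set.nonempty_iff_ne_empty.2 (hfX i)
    have hinj : Function.Injective x := fun i j hij => by
      by_contra hne
      exact Set.disjoint_left.1 (hfd i j hne) (hx i).2 (hij ▸ (hx j).2)
    calc n = (Set.range x).ncard := by
          rw [← Nat.card_coe_set_eq, Nat.card_range_of_injective hinj, Nat.card_fin]
      _ ≤ (X.points ∩ U).ncard := Set.ncard_le_ncard (by
          rintro _ ⟨i, rfl⟩; exact ⟨(hx i).1, hfU i (hx i).2⟩) hfin

section

variable {S : Type*} [TopologicalSpace S] [MeasurableSpace S]
  {Ω : Type*} [MeasurableSpace Ω] {ξ : Ω → Configuration S}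

/-- Open sets are handled by `le_ncard_inter_iff`, the other Borel sets by a π-λ induction. The
relatively compact window `W` keeps all counts finite, so that complements become differences and
`ncard` is the true count. -/
theorem measurable_ncard_inter [T2Space S] [SecondCountableTopology S] [BorelSpace S]
    (hξ : ∀ U : Set S, IsOpen U → (∃ C, IsCompact C ∧ U ⊆ C) →
      MeasurableSet {ω | (ξ ω).points ∩ U = ∅})
    {W C : Set S} (hW : IsOpen W) (hC : IsCompact C) (hWC : W ⊆ C) {B : Set S}
    (hB : MeasurableSet B) :
    Measurable fun ω => (((ξ ω).points ∩ (B ∩ W)).ncard : ℝ) := by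
  have hfin : ∀ ω, ((ξ ω).points ∩ W).Finite := fun ω =>
    ((ξ ω).finite_inter C hC).subset (by gcongr)
  have hopen : ∀ U : Set S, IsOpen U →
      Measurable fun ω => (((ξ ω).points ∩ (U ∩ W)).ncard : ℝ) := by
    intro U hU
    refine measurable_from_top.comp (g := fun n : ℕ => (n : ℝ)) ?_
    refine measurable_of_Ici fun n => ?_
    have hUW : U ∩ W ⊆ C := Set.inter_subset_right.trans hWC
    have : (fun ω => ((ξ ω).points ∩ (U ∩ W)).ncard) ⁻¹' Set.Ici n =
        ⋃ f : {f : Fin n → TopologicalSpace.countableBasis S // (∀ i, (f i : Set S) ⊆ U ∩ W) ∧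
          (∀ i j, i ≠ j → Disjoint (f i : Set S) (f j))},
          ⋂ i, {ω | (ξ ω).points ∩ f.1 i = ∅}ᶜ := by
      ext ω
      simp only [Set.mem_preimage, Set.mem_Ici, Set.mem_iUnion, Set.mem_iInter, Set.mem_compl_iff,
        Set.mem_ofPred_eq, le_ncard_inter_iff (ξ ω) (hU.inter hW) hC hUW n, Subtype.exists,
        exists_prop, and_assoc]
    rw [this]
    refine MeasurableSet.iUnion fun f => MeasurableSet.iInter fun i => (hξ _ ?_ ?_).compl
    · exact TopologicalSpace.isOpen_of_mem_countableBasis (f.1 i).2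
    · exact ⟨C, hC, (f.2.1 i).trans hUW⟩
  induction B, hB using MeasurableSpace.induction_on_inter
    (BorelSpace.measurable_eq (α := S)) isPiSystem_isOpen with
  | empty => simp
  | basic U hU => exact hopen U hU
  | compl A _ ih =>
    convert (hopen Set.univ isOpen_univ).sub ih using 2 with ω
    rw [Pi.sub_apply]
    simp only [ncard_inter_eq_sum_indicator (hfin ω), ← Finset.sum_sub_distrib]
    exact Finset.sum_congr rfl fun x _ => by by_cases h : x ∈ A <;> simp [h]
  | iUnion A hd _ ih =>
    have hlim : ∀ ω, Tendsto (fun n => ∑ i ∈ Finset.range n,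
        (((ξ ω).points ∩ (A i ∩ W)).ncard : ℝ)) atTop
        (𝓝 (((ξ ω).points ∩ ((⋃ i, A i) ∩ W)).ncard : ℝ)) := by
      intro ω
      simp only [ncard_inter_eq_sum_indicator (hfin ω)]
      simp only [Finset.sum_comm (s := Finset.range _)]
      refine tendsto_finsetSum _ fun x _ => HasSum.tendsto_sum_nat ?_
      by_cases hx : x ∈ ⋃ i, A i
      · obtain ⟨j, hj⟩ := Set.mem_iUnion.1 hx
        have := hasSum_single (f := fun i => (A i).indicator (fun _ => (1 : ℝ)) x) j
          fun i hi => Set.indicator_of_notMem (fun h => Set.disjoint_left.1 (hd hi) h hj) _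
        simpa [Set.indicator_of_mem hx, Set.indicator_of_mem hj] using this
      · have : ∀ i, x ∉ A i := fun i h => hx (Set.mem_iUnion_of_mem i h)
        have hz : ∀ i, (A i).indicator (fun _ => (1 : ℝ)) x = 0 := fun i =>
          Set.indicator_of_notMem (this i) _
        rw [Set.indicator_of_notMem hx]
        simp only [hz]
        exact hasSum_zero
    exact measurable_of_tendsto_metrizable (fun n => Finset.measurable_sum _ fun i _ => ih i)
      (tendsto_pi_nhds.2 hlim)

/-- A random configuration is measurable as soon as its avoidance events are. -/
theorem measurable_of_measurableSet_avoid [LocallyCompactSpace S] [T2Space S]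
    [SecondCountableTopology S] [BorelSpace S]
    (hξ : ∀ U : Set S, IsOpen U → (∃ C, IsCompact C ∧ U ⊆ C) →
      MeasurableSet {ω | (ξ ω).points ∩ U = ∅}) : Measurable ξ := by
  let E : CompactExhaustion S := default
  have hcount : ∀ B : Set S, MeasurableSet B → ∀ n : ℕ,
      MeasurableSet {ω | (n : ℕ∞) ≤ ((ξ ω).points ∩ B).encard} := by
    intro B hB n
    have : {ω | (n : ℕ∞) ≤ ((ξ ω).points ∩ B).encard} =
        ⋃ m, (fun ω => (((ξ ω).points ∩ (B ∩ interior (E m))).ncard : ℝ)) ⁻¹' Set.Ici (n : ℝ) := by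
      ext ω
      simp only [Set.mem_ofPred_eq, Set.mem_iUnion, Set.mem_preimage, Set.mem_Ici, Nat.cast_le]
      have hfin : ∀ m, ((ξ ω).points ∩ (B ∩ interior (E m))).Finite := fun m =>
        ((ξ ω).finite_inter _ (E.isCompact m)).subset fun x hx =>
          ⟨hx.1, interior_subset hx.2.2⟩
      constructor
      · intro h
        -- At least `n` points in `B` means a finite witness `t`, which already lies in one interior
        -- of the exhaustion.
        obtain ⟨t, htsub, htcard⟩ := Set.exists_subset_encard_eq h
        have htfin : t.Finite := Set.finite_of_encard_eq_coe htcard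
        have hev : ∀ x ∈ t, ∀ᶠ m in atTop, x ∈ interior (E m) := fun x _ => by
          filter_upwards [eventually_ge_atTop (E.find x + 1)] with m hm
          exact interior_mono (E.subset hm) (E.subset_interior_succ _ (E.mem_find x))
        obtain ⟨m, hm⟩ := ((eventually_all_finite htfin).2 hev).exists
        refine ⟨m, ?_⟩
        rw [← Nat.cast_le (α := ℕ∞), (hfin m).cast_ncard_eq, ← htcard]
        exact Set.encard_le_encard fun x hx => ⟨(htsub hx).1, (htsub hx).2, hm x hx⟩
      · rintro ⟨m, hm⟩
        rw [← Nat.cast_le (α := ℕ∞), (hfin m).cast_ncard_eq] at hm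
        exact hm.trans (Set.encard_le_encard fun x hx => ⟨hx.1, hx.2.1⟩)
    rw [this]
    exact MeasurableSet.iUnion fun m => measurable_ncard_inter hξ isOpen_interior (E.isCompact m)
      interior_subset hB measurableSet_Ici
  refine Measurable.of_le_map (iSup_le fun B => ?_)
  rw [← measurable_iff_le_map, measurable_iff_comap_le, MeasurableSpace.comap_comp,
    ← measurable_iff_comap_le]
  refine @measurable_to_countable' _ _ ⊤ _ _ _ fun a => ?_
  induction a using ENat.recTopCoe with
  | top =>
    have : ((fun X : Configuration S => (X.points ∩ B.1).encard) ∘ ξ) ⁻¹' {⊤} =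
        ⋂ n : ℕ, {ω | (n : ℕ∞) ≤ ((ξ ω).points ∩ B.1).encard} := by
      ext ω
      simp [ENat.eq_top_iff_forall_ge]
    rw [this]
    exact MeasurableSet.iInter fun n => hcount _ B.2 n
  | coe n =>
    have : ((fun X : Configuration S => (X.points ∩ B.1).encard) ∘ ξ) ⁻¹' {(n : ℕ∞)} =
        {ω | (n : ℕ∞) ≤ ((ξ ω).points ∩ B.1).encard} \
          {ω | ((n + 1 : ℕ) : ℕ∞) ≤ ((ξ ω).points ∩ B.1).encard} := by
      ext ω
      simp only [Set.mem_preimage, Function.comp, Set.mem_singleton_iff, Set.mem_sdiff,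
        Set.mem_ofPred_eq, Nat.cast_add, Nat.cast_one, ENat.add_one_le_iff (ENat.natCast_ne_top n),
        not_lt]
      exact ⟨fun h => ⟨h.ge, h.le⟩, fun h => le_antisymm h.2 h.1⟩
    rw [this]
    exact (hcount _ B.2 n).diff (hcount _ B.2 (n + 1))

theorem generateFrom_avoidEvents [LocallyCompactSpace S] [T2Space S]
    [SecondCountableTopology S] [BorelSpace S] :
    (inferInstance : MeasurableSpace (Configuration S)) =
      MeasurableSpace.generateFrom (avoidEvents S) := by
  refine le_antisymm ?_ (MeasurableSpace.generateFrom_le ?_)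
  · have := @measurable_of_measurableSet_avoid S _ _ (Configuration S)
      (MeasurableSpace.generateFrom (avoidEvents S)) id _ _ _ _
      fun U hU hC => MeasurableSpace.measurableSet_generateFrom ⟨U, hU, hC, rfl⟩
    intro s hs
    exact this hs
  · rintro _ ⟨U, hU, -, rfl⟩
    exact measurableSet_avoid hU.measurableSet

end

/-! ### The reference measure -/

instance : IsFiniteMeasureOnCompacts (Measure.count : Measure ℤ) :=
  ⟨fun _ hC => Measure.count_apply_lt_top.2 (isCompact_iff_finite.1 hC)⟩

instance : IsFiniteMeasureOnCompacts (Measure.comap ((↑) : ℝ≥0 → ℝ) volume) where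
  lt_top_of_isCompact C hC := by
    rw [NNReal.isClosedEmbedding_coe.measurableEmbedding.comap_apply]
    exact (hC.image NNReal.continuous_coe).measure_lt_top

instance : IsFiniteMeasureOnCompacts refMeasure := by
  unfold refMeasure; infer_instance

instance : SigmaFinite refMeasure := by
  unfold refMeasure; infer_instance

theorem measurePreserving_shift (h : ℤ) : MeasurePreserving (shift h) refMeasure refMeasure :=
  (measurePreserving_add_right (Measure.count : Measure ℤ) (2 * h)).prod
    (MeasurePreserving.id (Measure.comap ((↑) : ℝ≥0 → ℝ) volume))

/-! ### The edge kernel -/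

/-- A translation by `2 h` adds `π h` to both phases. Each cosine picks up the sign `(-1) ^ h` and
the two signs cancel, which is why the translations are even. -/
theorem edgeIntegrand_shift (h x₁ : ℤ) (u₁ : ℝ≥0) (x₂ : ℤ) (u₂ : ℝ≥0) (t : ℝ) :
    edgeIntegrand (x₁ + 2 * h) u₁ (x₂ + 2 * h) u₂ t = edgeIntegrand x₁ u₁ x₂ u₂ t := by
  have hc : ∀ (x : ℤ) (u : ℝ≥0), Real.cos (t * u + Real.pi / 2 * (x + 2 * h : ℤ)) =
      (-1) ^ h * Real.cos (t * u + Real.pi / 2 * x) := fun x u => by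
    rw [← Real.cos_add_int_mul_pi]; congr 1; push_cast; ring
  have hs : ((-1 : ℝ) ^ h) * (-1) ^ h = 1 := by
    rw [← mul_zpow]; norm_num
  simp only [edgeIntegrand, hc, add_sub_add_right_eq_sub]
  linear_combination t ^ (x₂ - x₁) * Real.cos (t * u₁ + Real.pi / 2 * x₁) *
    Real.cos (t * u₂ + Real.pi / 2 * x₂) * hs

theorem edgeKernel_shift (h : ℤ) (p q : ℤ × ℝ≥0) :
    edgeKernel (shift h p) (shift h q) = edgeKernel p q := by
  have h1 : ∀ p : ℤ × ℝ≥0, shift h p = (p.1 + 2 * h, p.2) := fun _ => rfl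
  simp only [edgeKernel, h1, edgeIntegrand_shift, add_le_add_iff_right]

theorem norm_edgeIntegrand_le (x₁ : ℤ) (u₁ : ℝ≥0) (x₂ : ℤ) (u₂ : ℝ≥0) {t : ℝ} (ht : 0 ≤ t) :
    ‖edgeIntegrand x₁ u₁ x₂ u₂ t‖ ≤ t ^ (x₂ - x₁) := by
  rw [edgeIntegrand, norm_mul, norm_mul, norm_zpow, Real.norm_of_nonneg ht, mul_assoc]
  refine mul_le_of_le_one_right (zpow_nonneg ht _) (mul_le_one₀ ?_ (norm_nonneg _) ?_)
  · exact Real.abs_cos_le_one _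
  · exact Real.abs_cos_le_one _

/-- The cosines are bounded by `1` and `t ^ n` integrates to `1 / (n + 1)` on `[0, 1]`. -/
theorem abs_edgeKernel_le_of_le {p q : ℤ × ℝ≥0} (h : p.1 ≤ q.1) :
    |edgeKernel p q| ≤ 2 / Real.pi * (((q.1 - p.1 : ℤ) : ℝ) + 1)⁻¹ := by
  have hn : 0 ≤ q.1 - p.1 := by omega
  have hint : ‖∫ t in (0 : ℝ)..1, edgeIntegrand p.1 p.2 q.1 q.2 t‖ ≤
      ∫ t in (0 : ℝ)..1, t ^ (q.1 - p.1) :=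
    intervalIntegral.norm_integral_le_of_norm_le zero_le_one
      (ae_of_all _ fun t ht => norm_edgeIntegrand_le _ _ _ _ ht.1.le)
      (intervalIntegral.intervalIntegrable_zpow (Or.inl hn))
  rw [integral_zpow (Or.inl hn), one_zpow, zero_zpow _ (by omega), sub_zero, one_div] at hint
  rw [edgeKernel, if_pos h, abs_mul, abs_of_pos (div_pos two_pos Real.pi_pos)]
  gcongr
  exact hint

theorem tendsto_limUnder_edgeIntegrand {p q : ℤ × ℝ≥0} (h : ¬ p.1 ≤ q.1) :
    Tendsto (fun T : ℝ => ∫ t in (1 : ℝ)..T, edgeIntegrand p.1 p.2 q.1 q.2 t) atTop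
      (𝓝 (limUnder atTop fun T : ℝ => ∫ t in (1 : ℝ)..T, edgeIntegrand p.1 p.2 q.1 q.2 t)) :=
  tendsto_nhds_limUnder (exists_tendsto_edgeIntegrand _ _ _ _ (not_le.1 h))

theorem abs_edgeKernel_le_of_forall {p q : ℤ × ℝ≥0} (h : ¬ p.1 ≤ q.1) {c : ℝ}
    (hc : ∀ T : ℝ, 1 ≤ T → |∫ t in (1 : ℝ)..T, edgeIntegrand p.1 p.2 q.1 q.2 t| ≤ c) :
    |edgeKernel p q| ≤ 2 / Real.pi * c := by
  rw [edgeKernel, if_neg h, abs_mul, abs_neg, abs_of_pos (div_pos two_pos Real.pi_pos)]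
  gcongr
  refine le_of_tendsto (tendsto_limUnder_edgeIntegrand h).abs ?_
  filter_upwards [eventually_ge_atTop 1] with T hT using hc T hT

theorem abs_edgeKernel_le_of_add_two_le {p q : ℤ × ℝ≥0} (h : q.1 + 2 ≤ p.1) :
    |edgeKernel p q| ≤ 2 / Real.pi * (((p.1 - q.1 : ℤ) : ℝ) - 1)⁻¹ := by
  refine abs_edgeKernel_le_of_forall (by omega) fun T hT => ?_
  have h0 : (0 : ℝ) ∉ Set.uIcc 1 T := by
    rw [Set.uIcc_of_le hT]; exact fun h => absurd h.1 (by norm_num)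
  have hint : ‖∫ t in (1 : ℝ)..T, edgeIntegrand p.1 p.2 q.1 q.2 t‖ ≤
      ∫ t in (1 : ℝ)..T, t ^ (q.1 - p.1) :=
    intervalIntegral.norm_integral_le_of_norm_le hT
      (ae_of_all _ fun t ht => norm_edgeIntegrand_le _ _ _ _ (zero_le_one.trans ht.1.le))
      (intervalIntegral.intervalIntegrable_zpow (Or.inr h0))
  rw [integral_zpow (Or.inr ⟨by omega, h0⟩), one_zpow] at hint
  refine hint.trans ?_
  have hm : (0 : ℝ) < ((p.1 - q.1 : ℤ) : ℝ) - 1 := by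
    have : (2 : ℝ) ≤ ((p.1 - q.1 : ℤ) : ℝ) := by exact_mod_cast (by omega : 2 ≤ p.1 - q.1)
    linarith
  have hz : 0 ≤ T ^ (q.1 - p.1 + 1) := zpow_nonneg (zero_le_one.trans hT) _
  have he : ((q.1 - p.1 : ℤ) : ℝ) + 1 = -(((p.1 - q.1 : ℤ) : ℝ) - 1) := by push_cast; ring
  rw [he, div_neg, ← neg_div, neg_sub, ← one_div]
  gcongr
  linarith

/-- The bound must be uniform in the frequency `c`, so the integral is split at `t = 1 / |c|`.
Below, `cos γ = 0` gives `|cos (c t + γ)| ≤ |c| t`, and the contribution is at most `1`. Above,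
integration by parts bounds it by `2 / (|c| b) ≤ 2`, where `b` is the lower endpoint. -/
theorem abs_integral_inv_mul_cos_le {c γ : ℝ} (hγ : Real.cos γ = 0) {T : ℝ} (hT : 1 ≤ T) :
    |∫ t in (1 : ℝ)..T, t⁻¹ * Real.cos (c * t + γ)| ≤ 3 := by
  by_cases hc : c = 0
  · simp [hc, hγ]
  have hc' : 0 < |c| := abs_pos.2 hc
  have hii : ∀ a b : ℝ, 1 ≤ a → 1 ≤ b →
      IntervalIntegrable (fun t : ℝ => t⁻¹ * Real.cos (c * t + γ)) volume a b := fun a b ha hb => by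
    refine ContinuousOn.intervalIntegrable (ContinuousOn.mul (continuousOn_id.inv₀ ?_)
      (by fun_prop))
    intro t ht
    exact (one_pos.trans_le ((le_inf ha hb).trans ht.1)).ne'
  have hsmall : ∀ b : ℝ, 1 ≤ b → (1 < b → |c| * b ≤ 1) →
      |∫ t in (1 : ℝ)..b, t⁻¹ * Real.cos (c * t + γ)| ≤ 1 := by
    intro b hb hcb
    have h1 : ‖∫ t in (1 : ℝ)..b, t⁻¹ * Real.cos (c * t + γ)‖ ≤ |c| * |b - 1| := by
      refine intervalIntegral.norm_integral_le_of_norm_le_const fun t ht => ?_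
      rw [Set.uIoc_of_le hb] at ht
      have ht0 : 0 < t := one_pos.trans ht.1
      have h2 := Real.abs_cos_sub_cos_le (c * t + γ) γ
      rw [hγ, sub_zero, add_sub_cancel_right, abs_mul, abs_of_pos ht0] at h2
      rw [norm_mul, norm_inv, Real.norm_of_nonneg ht0.le, inv_mul_le_iff₀ ht0, mul_comm t]
      exact h2
    refine h1.trans ?_
    rw [abs_of_nonneg (sub_nonneg.2 hb)]
    rcases eq_or_lt_of_le hb with rfl | hb'
    · simp
    · nlinarith [hcb hb']
  have hlarge : ∀ b : ℝ, 1 ≤ b → b ≤ T → 1 ≤ |c| * b →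
      |∫ t in b..T, t⁻¹ * Real.cos (c * t + γ)| ≤ 2 := by
    intro b hb hbT hcb
    have hb0 : 0 < b := one_pos.trans_le hb
    have hT0 : 0 < T := hb0.trans_le hbT
    have hpos : ∀ t ∈ Set.uIcc b T, t ≠ 0 := fun t ht => by
      rw [Set.uIcc_of_le hbT] at ht
      exact (hb0.trans_le ht.1).ne'
    have key := intervalIntegral.integral_mul_deriv_eq_deriv_mul (a := b) (b := T)
      (u := fun t : ℝ => t⁻¹) (u' := fun t => -(t ^ 2)⁻¹)
      (v := fun t => Real.sin (c * t + γ) / c) (v' := fun t => Real.cos (c * t + γ))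
      (fun t ht => hasDerivAt_inv (hpos t ht))
      (fun t _ => by
        have := (((hasDerivAt_id t).const_mul c).add_const γ).sin.div_const c
        simpa [hc] using this)
      (ContinuousOn.intervalIntegrable
        (ContinuousOn.neg (ContinuousOn.inv₀ (by fun_prop) fun t ht => pow_ne_zero 2 (hpos t ht))))
      (Continuous.intervalIntegrable (by fun_prop) _ _)
    have hsin : ∀ t : ℝ, |Real.sin (c * t + γ) / c| ≤ |c|⁻¹ := fun t => by
      rw [abs_div, div_eq_mul_inv]
      exact mul_le_of_le_one_left (inv_nonneg.2 hc'.le) (Real.abs_sin_le_one _)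
    have hzp : ∀ t : ℝ, (t ^ 2)⁻¹ = t ^ (-2 : ℤ) := fun t => by
      rw [zpow_neg]; norm_cast
    have h0 : (0 : ℝ) ∉ Set.uIcc b T := fun h => hpos 0 h rfl
    have hI : ‖∫ t in b..T, -(t ^ 2)⁻¹ * (Real.sin (c * t + γ) / c)‖ ≤
        ∫ t in b..T, t ^ (-2 : ℤ) * |c|⁻¹ := by
      refine intervalIntegral.norm_integral_le_of_norm_le hbT (ae_of_all _ fun t ht => ?_)
        ((intervalIntegral.intervalIntegrable_zpow (Or.inr h0)).mul_const _)
      rw [norm_mul, norm_neg, hzp, Real.norm_of_nonneg (zpow_nonneg (hb0.trans ht.1).le _)]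
      exact mul_le_mul_of_nonneg_left (hsin t) (zpow_nonneg (hb0.trans ht.1).le _)
    rw [intervalIntegral.integral_mul_const, integral_zpow (Or.inr ⟨by norm_num, h0⟩)] at hI
    have e2 : (T ^ (-2 + 1 : ℤ) - b ^ (-2 + 1 : ℤ)) / (((-2 : ℤ) : ℝ) + 1) = b⁻¹ - T⁻¹ := by
      norm_num
      ring
    rw [e2] at hI
    have hA : |T⁻¹ * (Real.sin (c * T + γ) / c)| ≤ T⁻¹ * |c|⁻¹ := by
      rw [abs_mul, abs_of_pos (inv_pos.2 hT0)]; gcongr; exact hsin T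
    have hB : |b⁻¹ * (Real.sin (c * b + γ) / c)| ≤ b⁻¹ * |c|⁻¹ := by
      rw [abs_mul, abs_of_pos (inv_pos.2 hb0)]; gcongr; exact hsin b
    have hfin : b⁻¹ * |c|⁻¹ ≤ 1 := by
      rw [← mul_inv, mul_comm]; exact inv_le_one_of_one_le₀ hcb
    rw [key]
    rw [Real.norm_eq_abs] at hI
    rw [abs_le] at hI hA hB ⊢
    constructor <;> linarith [hI.1, hI.2, hA.1, hA.2, hB.1, hB.2]
  -- The splitting point `1 / |c|` may fall to the left of `1`, to the right of `T`, or in between.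
  rcases le_total 1 |c| with h1 | h1
  · exact (hlarge 1 le_rfl hT (by simpa using h1)).trans (by norm_num)
  rcases le_total T |c|⁻¹ with h2 | h2
  · refine (hsmall T hT fun _ => ?_).trans (by norm_num)
    calc |c| * T ≤ |c| * |c|⁻¹ := by gcongr
      _ = 1 := mul_inv_cancel₀ hc'.ne'
  have h3 : 1 ≤ |c|⁻¹ := (one_le_inv₀ hc').2 h1
  rw [← intervalIntegral.integral_add_adjacent_intervals (hii 1 |c|⁻¹ le_rfl h3)
    (hii |c|⁻¹ T h3 hT)]
  have h4 := hsmall |c|⁻¹ h3 fun _ => (mul_inv_cancel₀ hc'.ne').le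
  have h5 := hlarge |c|⁻¹ h3 h2 (mul_inv_cancel₀ hc'.ne').ge
  exact (abs_add_le _ _).trans (by linarith)

/-- The product of cosines is half a sum of two cosines with phases `π (x₁ ± x₂) / 2`. Both `x₁ ±
x₂` are odd, so both phases have zero cosine and the uniform bound `3` applies to each. -/
theorem abs_edgeKernel_le_of_add_one_eq {p q : ℤ × ℝ≥0} (h : q.1 + 1 = p.1) :
    |edgeKernel p q| ≤ 2 / Real.pi * 3 := by
  refine abs_edgeKernel_le_of_forall (by omega) fun T hT => ?_
  obtain ⟨x₁, u₁⟩ := p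
  obtain ⟨x₂, u₂⟩ := q
  simp only at h ⊢
  have hodd : ∀ y : ℤ, Odd y → Real.cos (Real.pi / 2 * y) = 0 := by
    rintro y ⟨m, rfl⟩
    refine Real.cos_eq_zero_iff.2 ⟨m, ?_⟩
    push_cast
    ring
  have ha := abs_integral_inv_mul_cos_le (c := (u₁ : ℝ) + u₂)
    (hodd (x₁ + x₂) ⟨x₂, by omega⟩) hT
  have hb := abs_integral_inv_mul_cos_le (c := (u₁ : ℝ) - u₂)
    (hodd (x₁ - x₂) ⟨0, by omega⟩) hT
  have hii : ∀ c γ : ℝ, IntervalIntegrable (fun t : ℝ => t⁻¹ * Real.cos (c * t + γ))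
      volume 1 T := fun c γ => by
    refine ContinuousOn.intervalIntegrable (ContinuousOn.mul (continuousOn_id.inv₀ ?_)
      (by fun_prop))
    intro t ht
    rw [Set.uIcc_of_le hT] at ht
    exact (one_pos.trans_le ht.1).ne'
  have key : ∫ t in (1 : ℝ)..T, edgeIntegrand x₁ u₁ x₂ u₂ t =
      2⁻¹ * ((∫ t in (1 : ℝ)..T, t⁻¹ * Real.cos (((u₁ : ℝ) + u₂) * t +
        Real.pi / 2 * (x₁ + x₂ : ℤ))) +
      ∫ t in (1 : ℝ)..T, t⁻¹ * Real.cos (((u₁ : ℝ) - u₂) * t + Real.pi / 2 * (x₁ - x₂ : ℤ))) := by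
    rw [← intervalIntegral.integral_add (hii _ _) (hii _ _),
      ← intervalIntegral.integral_const_mul]
    refine intervalIntegral.integral_congr fun t _ => ?_
    simp only [edgeIntegrand, show x₂ - x₁ = -1 by omega, zpow_neg_one]
    have e1 : ((u₁ : ℝ) + u₂) * t + Real.pi / 2 * (x₁ + x₂ : ℤ)
        = (t * u₁ + Real.pi / 2 * x₁) + (t * u₂ + Real.pi / 2 * x₂) := by push_cast; ring
    have e2 : ((u₁ : ℝ) - u₂) * t + Real.pi / 2 * (x₁ - x₂ : ℤ)
        = (t * u₁ + Real.pi / 2 * x₁) - (t * u₂ + Real.pi / 2 * x₂) := by push_cast; ring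
    rw [e1, e2, Real.cos_add (t * u₁ + Real.pi / 2 * x₁), Real.cos_sub]
    ring
  rw [key, abs_mul, abs_of_pos (by norm_num : (0 : ℝ) < 2⁻¹)]
  linarith [abs_add_le (∫ t in (1 : ℝ)..T, t⁻¹ * Real.cos (((u₁ : ℝ) + u₂) * t +
        Real.pi / 2 * (x₁ + x₂ : ℤ)))
      (∫ t in (1 : ℝ)..T, t⁻¹ * Real.cos (((u₁ : ℝ) - u₂) * t + Real.pi / 2 * (x₁ - x₂ : ℤ)))]

theorem abs_edgeKernel_le (p q : ℤ × ℝ≥0) : |edgeKernel p q| ≤ 2 / Real.pi * 3 := by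
  have hpi : 0 < 2 / Real.pi := div_pos two_pos Real.pi_pos
  rcases le_or_gt p.1 q.1 with h | h
  · refine (abs_edgeKernel_le_of_le h).trans (mul_le_mul_of_nonneg_left ?_ hpi.le)
    have : (0 : ℝ) ≤ ((q.1 - p.1 : ℤ) : ℝ) := by exact_mod_cast (by omega : 0 ≤ q.1 - p.1)
    exact (inv_le_one_of_one_le₀ (by linarith)).trans (by norm_num)
  rcases eq_or_lt_of_le (Int.add_one_le_iff.2 h) with h | h
  · exact abs_edgeKernel_le_of_add_one_eq h
  · refine (abs_edgeKernel_le_of_add_two_le (by omega)).trans (mul_le_mul_of_nonneg_left ?_ hpi.le)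
    have : (2 : ℝ) ≤ ((p.1 - q.1 : ℤ) : ℝ) := by exact_mod_cast (by omega : 2 ≤ p.1 - q.1)
    exact (inv_le_one_of_one_le₀ (by linarith)).trans (by norm_num)

theorem tendsto_edgeKernel_shift_right (p q : ℤ × ℝ≥0) :
    Tendsto (fun n : ℕ => edgeKernel p (shift n q)) atTop (𝓝 0) := by
  have hlim : Tendsto (fun n : ℕ => ((q.1 + 2 * n - p.1 : ℤ) : ℝ) + 1) atTop atTop := by
    have h1 : Tendsto (fun n : ℕ => (2 : ℝ) * n + ((q.1 : ℝ) - p.1 + 1)) atTop atTop :=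
      tendsto_atTop_add_const_right _ _ (tendsto_natCast_atTop_atTop.const_mul_atTop two_pos)
    refine h1.congr fun n => ?_
    push_cast; ring
  have hz := (tendsto_inv_atTop_zero.comp hlim).const_mul (2 / Real.pi)
  rw [mul_zero] at hz
  refine squeeze_zero_norm' ?_ hz
  filter_upwards [eventually_ge_atTop (p.1 - q.1).toNat] with n hn
  exact abs_edgeKernel_le_of_le (q := shift n q) (show p.1 ≤ q.1 + 2 * (n : ℤ) by omega)

theorem tendsto_edgeKernel_shift_left (p q : ℤ × ℝ≥0) :
    Tendsto (fun n : ℕ => edgeKernel (shift n p) q) atTop (𝓝 0) := by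
  have hlim : Tendsto (fun n : ℕ => ((p.1 + 2 * n - q.1 : ℤ) : ℝ) - 1) atTop atTop := by
    have h1 : Tendsto (fun n : ℕ => (2 : ℝ) * n + ((p.1 : ℝ) - q.1 - 1)) atTop atTop :=
      tendsto_atTop_add_const_right _ _ (tendsto_natCast_atTop_atTop.const_mul_atTop two_pos)
    refine h1.congr fun n => ?_
    push_cast; ring
  have hz := (tendsto_inv_atTop_zero.comp hlim).const_mul (2 / Real.pi)
  rw [mul_zero] at hz
  refine squeeze_zero_norm' ?_ hz
  -- The extra `1` produces the gap of two needed for the absolutely convergent bound.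
  filter_upwards [eventually_ge_atTop ((q.1 - p.1).toNat + 1)] with n hn
  exact abs_edgeKernel_le_of_add_two_le (p := shift n p)
    (show q.1 + 2 ≤ p.1 + 2 * (n : ℤ) by omega)

theorem measurable_intervalIntegral_edgeIntegrand (x₁ x₂ : ℤ) {a b : ℝ} (hab : a ≤ b) :
    Measurable fun u : ℝ≥0 × ℝ≥0 => ∫ t in a..b, edgeIntegrand x₁ u.1 x₂ u.2 t := by
  simp only [intervalIntegral.integral_of_le hab]
  refine StronglyMeasurable.measurable (StronglyMeasurable.integral_prod_right
    (f := fun (u : ℝ≥0 × ℝ≥0) t => edgeIntegrand x₁ u.1 x₂ u.2 t) ?_)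
  refine Measurable.stronglyMeasurable ?_
  simp only [edgeIntegrand, Function.uncurry_def]
  fun_prop

theorem measurable_edgeKernel : Measurable (Function.uncurry edgeKernel) := by
  have hx : ∀ x : ℤ × ℤ, Measurable fun u : ℝ≥0 × ℝ≥0 => edgeKernel (x.1, u.1) (x.2, u.2) := by
    intro x
    by_cases h : x.1 ≤ x.2
    · simp only [edgeKernel, if_pos h]
      exact (measurable_intervalIntegral_edgeIntegrand _ _ zero_le_one).const_mul _
    · simp only [edgeKernel, if_neg h]
      refine Measurable.const_mul ?_ _
      -- The limit is taken along the integers `n + 1`, which keeps the upper endpoint at least `1`.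
      refine measurable_of_tendsto_metrizable (f := fun (n : ℕ) (u : ℝ≥0 × ℝ≥0) =>
        ∫ t in (1 : ℝ)..(n + 1 : ℕ), edgeIntegrand x.1 u.1 x.2 u.2 t) (fun n =>
        measurable_intervalIntegral_edgeIntegrand _ _ (by simp)) (tendsto_pi_nhds.2 fun u => ?_)
      exact (tendsto_limUnder_edgeIntegrand (p := (x.1, u.1)) (q := (x.2, u.2)) h).comp
        (tendsto_natCast_atTop_atTop.comp (tendsto_add_atTop_nat 1))
  -- The integer coordinates range over a countable set, so measurability in the continuous ones
  -- suffices.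
  have := measurable_from_prod_countable_right
    (f := fun y : (ℤ × ℤ) × (ℝ≥0 × ℝ≥0) => edgeKernel (y.1.1, y.2.1) (y.1.2, y.2.2)) hx
  exact this.comp (f := fun z : (ℤ × ℝ≥0) × (ℤ × ℝ≥0) => ((z.1.1, z.2.1), (z.1.2, z.2.2)))
    (by fun_prop)

/-! ### Translations of configurations -/

theorem shift_neg_shift (h : ℤ) (p : ℤ × ℝ≥0) : shift (-h) (shift h p) = p := by
  change (p.1 + 2 * h + 2 * -h, p.2) = p
  ext1
  · change p.1 + 2 * h + 2 * -h = p.1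
    ring
  · rfl

theorem shiftConfig_neg_shiftConfig (h : ℤ) (X : Configuration (ℤ × ℝ≥0)) :
    shiftConfig (-h) (shiftConfig h X) = X := by
  ext1
  change shift (-h) '' (shift h '' X.points) = X.points
  simp [Set.image_image, shift_neg_shift]

theorem shiftConfig_preimage_avoid (h : ℤ) (U : Set (ℤ × ℝ≥0)) :
    shiftConfig h ⁻¹' {X | X.points ∩ U = ∅} = {X | X.points ∩ shift h ⁻¹' U = ∅} := by
  ext X
  change shift h '' X.points ∩ U = ∅ ↔ X.points ∩ shift h ⁻¹' U = ∅
  rw [← Set.image_inter_preimage, Set.image_eq_empty]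

theorem exists_isCompact_preimage_shift (h : ℤ) {U : Set (ℤ × ℝ≥0)}
    (hU : ∃ C, IsCompact C ∧ U ⊆ C) : ∃ C, IsCompact C ∧ shift h ⁻¹' U ⊆ C := by
  obtain ⟨C, hC, hUC⟩ := hU
  exact ⟨shift h ⁻¹' C, (shift h).isCompact_preimage.2 hC, Set.preimage_mono hUC⟩

theorem measurable_shiftConfig (h : ℤ) : Measurable (shiftConfig h) :=
  measurable_of_measurableSet_avoid fun U hU _ => by
    have := shiftConfig_preimage_avoid h U
    rw [Set.preimage_ofPred_eq] at this
    rw [this]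
    exact measurableSet_avoid (hU.preimage (shift h).continuous).measurableSet

theorem IsInvariantEvent.preimage_shiftConfig {E : Set (Configuration (ℤ × ℝ≥0))}
    (hE : IsInvariantEvent E) (h : ℤ) : shiftConfig h ⁻¹' E = E := by
  conv_rhs => rw [← hE.2 (-h)]
  refine (congrFun (Set.image_eq_preimage_of_inverse (fun X => ?_)
    (shiftConfig_neg_shiftConfig h)) E).symm
  simpa using shiftConfig_neg_shiftConfig (-h) X

/-- Bounded sets are moved apart by translations. -/
theorem eventually_disjoint_shift {U V : Set (ℤ × ℝ≥0)} (hU : ∃ C, IsCompact C ∧ U ⊆ C)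
    (hV : ∃ C, IsCompact C ∧ V ⊆ C) :
    ∀ᶠ n : ℕ in atTop, Disjoint U (shift (-n) ⁻¹' V) := by
  have hbd : ∀ U : Set (ℤ × ℝ≥0), (∃ C, IsCompact C ∧ U ⊆ C) → ∃ N : ℕ, ∀ p ∈ U, |p.1| ≤ N := by
    rintro U ⟨C, hC, hUC⟩
    obtain ⟨b, hb⟩ := hC.exists_bound_of_continuousOn (f := fun p : ℤ × ℝ≥0 => p.1)
      continuous_fst.continuousOn
    refine ⟨⌈b⌉₊, fun p hp => ?_⟩
    have h1 := (hb p (hUC hp)).trans (Nat.le_ceil b)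
    rw [Int.norm_eq_abs] at h1
    exact_mod_cast h1
  obtain ⟨a, ha⟩ := hbd U hU
  obtain ⟨b, hb⟩ := hbd V hV
  filter_upwards [eventually_gt_atTop (a + b)] with n hn
  refine Set.disjoint_left.2 fun p hp hp' => ?_
  have h1 := abs_le.1 (ha p hp)
  have h2 : |p.1 + 2 * (-(n : ℤ))| ≤ b := hb _ hp'
  rw [abs_le] at h2
  omega

/-! ### Mixing and ergodicity -/

section

variable {Ω : Type*} [MeasurableSpace Ω] {P : Measure Ω} [IsProbabilityMeasure P]
  {X : Ω → Configuration (ℤ × ℝ≥0)}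

theorem IsDeterminantal.map_real_avoid (hX : IsDeterminantal edgeKernel refMeasure P X)
    {U : Set (ℤ × ℝ≥0)} (hU : IsOpen U) (hUC : ∃ C, IsCompact C ∧ U ⊆ C) :
    (P.map X).real {X | X.points ∩ U = ∅} = fredholm edgeKernel (refMeasure.restrict U) := by
  obtain ⟨C, hC, hUC⟩ := hUC
  rw [map_measureReal_apply hX.measurable (measurableSet_avoid hU.measurableSet)]
  exact hX.measureReal_avoid measurable_edgeKernel abs_edgeKernel_le hU hC hUC

theorem isFiniteMeasure_restrict_refMeasure {U : Set (ℤ × ℝ≥0)}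
    (hUC : ∃ C, IsCompact C ∧ U ⊆ C) : IsFiniteMeasure (refMeasure.restrict U) := by
  obtain ⟨C, hC, hUC⟩ := hUC
  exact isFiniteMeasure_restrict.2 ((measure_mono hUC).trans_lt hC.measure_lt_top).ne

theorem map_shift_restrict (h : ℤ) {U : Set (ℤ × ℝ≥0)} (hU : IsOpen U) :
    (refMeasure.restrict (shift h ⁻¹' U)).map (shift h) = refMeasure.restrict U :=
  ((measurePreserving_shift h).restrict_preimage hU.measurableSet).map_eq

theorem restrict_preimage_shift_neg (h : ℤ) {U : Set (ℤ × ℝ≥0)} (hU : IsOpen U) :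
    refMeasure.restrict (shift (-h) ⁻¹' U) = (refMeasure.restrict U).map (shift h) := by
  have h1 : shift h ⁻¹' (shift (-h) ⁻¹' U) = U := by
    ext p; simp [shift_neg_shift]
  rw [← map_shift_restrict h (hU.preimage (shift (-h)).continuous), h1]

/-- The law of the process is invariant under translations. -/
theorem IsDeterminantal.measurePreserving_shiftConfig
    (hX : IsDeterminantal edgeKernel refMeasure P X) (h : ℤ) :
    MeasurePreserving (shiftConfig h) (P.map X) (P.map X) := by
  have := Measure.isProbabilityMeasure_map (μ := P) hX.measurable.aemeasurable
  have := Measure.isProbabilityMeasure_map (μ := P.map X) (measurable_shiftConfig h).aemeasurable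
  refine ⟨measurable_shiftConfig h, ext_of_generate_finite (avoidEvents (ℤ × ℝ≥0))
    generateFrom_avoidEvents (isPiSystem_avoidEvents _) ?_ (by simp)⟩
  rintro _ ⟨U, hU, hUC, rfl⟩
  have hV : IsOpen (shift h ⁻¹' U) := hU.preimage (shift h).continuous
  have hVC := exists_isCompact_preimage_shift h hUC
  have := isFiniteMeasure_restrict_refMeasure hVC
  rw [Measure.map_apply (measurable_shiftConfig h) (measurableSet_avoid hU.measurableSet),
    shiftConfig_preimage_avoid, ← measureReal_eq_measureReal_iff, hX.map_real_avoid hV hVC,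
    hX.map_real_avoid hU hUC, ← map_shift_restrict h hU,
    fredholm_map measurable_edgeKernel (shift h).continuous.measurable (edgeKernel_shift h)]

/-- Avoiding both `U` and a translate of `V` is avoiding their union. Once these are disjoint, the
restricted reference measure is a sum whose second part is a push-forward, as `tendsto_fredholm`
requires. -/
theorem IsDeterminantal.tendsto_avoid_inter (hX : IsDeterminantal edgeKernel refMeasure P X)
    {U V : Set (ℤ × ℝ≥0)} (hU : IsOpen U) (hUC : ∃ C, IsCompact C ∧ U ⊆ C)
    (hV : IsOpen V) (hVC : ∃ C, IsCompact C ∧ V ⊆ C) :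
    Tendsto (fun n : ℕ => (P.map X).real
        ({X | X.points ∩ U = ∅} ∩ shiftConfig (-n) ⁻¹' {X | X.points ∩ V = ∅})) atTop
      (𝓝 ((P.map X).real {X | X.points ∩ U = ∅} * (P.map X).real {X | X.points ∩ V = ∅})) := by
  have := isFiniteMeasure_restrict_refMeasure hUC
  have := isFiniteMeasure_restrict_refMeasure hVC
  rw [hX.map_real_avoid hU hUC, hX.map_real_avoid hV hVC]
  refine (tendsto_fredholm measurable_edgeKernel abs_edgeKernel_le
    (g := fun n : ℕ => shift n) (fun n => (shift n).continuous.measurable)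
    (fun n => edgeKernel_shift n) tendsto_edgeKernel_shift_right tendsto_edgeKernel_shift_left
    (refMeasure.restrict U) (refMeasure.restrict V)).congr' ?_
  filter_upwards [eventually_disjoint_shift hUC hVC] with n hn
  have hVn : IsOpen (shift (-n) ⁻¹' V) := hV.preimage (shift (-n)).continuous
  obtain ⟨C, hC, hUC⟩ := hUC
  obtain ⟨D, hD, hVD⟩ := exists_isCompact_preimage_shift (-n) hVC
  have hinter : {X : Configuration (ℤ × ℝ≥0) | X.points ∩ U = ∅} ∩
      {X | X.points ∩ shift (-n) ⁻¹' V = ∅} = {X | X.points ∩ (U ∪ shift (-n) ⁻¹' V) = ∅} := by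
    ext X
    simp [Set.inter_union_distrib_left, Set.union_empty_iff]
  rw [shiftConfig_preimage_avoid, hinter, hX.map_real_avoid (hU.union hVn)
    ⟨C ∪ D, hC.union hD, Set.union_subset_union hUC hVD⟩,
    Measure.restrict_union hn hVn.measurableSet, restrict_preimage_shift_neg _ hV]

/-- Mixing: a translated event becomes independent of any avoidance event. -/
theorem IsDeterminantal.tendsto_avoid_inter_preimage
    (hX : IsDeterminantal edgeKernel refMeasure P X)
    {U : Set (ℤ × ℝ≥0)} (hU : IsOpen U) (hUC : ∃ C, IsCompact C ∧ U ⊆ C)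
    {B : Set (Configuration (ℤ × ℝ≥0))} (hB : MeasurableSet B) :
    Tendsto (fun n : ℕ => (P.map X).real
        ({X | X.points ∩ U = ∅} ∩ shiftConfig (-n) ⁻¹' B)) atTop
      (𝓝 ((P.map X).real {X | X.points ∩ U = ∅} * (P.map X).real B)) := by
  have := Measure.isProbabilityMeasure_map (μ := P) hX.measurable.aemeasurable
  have hA : MeasurableSet {X : Configuration (ℤ × ℝ≥0) | X.points ∩ U = ∅} :=
    measurableSet_avoid hU.measurableSet
  set A := {X : Configuration (ℤ × ℝ≥0) | X.points ∩ U = ∅}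
  induction B, hB using MeasurableSpace.induction_on_inter
    (generateFrom_avoidEvents (S := ℤ × ℝ≥0)) (isPiSystem_avoidEvents _) with
  | empty => simp
  | basic B hB =>
    obtain ⟨V, hV, hVC, rfl⟩ := hB
    exact hX.tendsto_avoid_inter hU hUC hV hVC
  | compl B hB ih =>
    rw [probReal_compl_eq_one_sub hB, mul_sub, mul_one]
    refine (ih.const_sub _).congr fun n => ?_
    rw [Set.preimage_compl, ← Set.sdiff_eq,
      ← measureReal_inter_add_sdiff (s := A) (measurable_shiftConfig (-n) hB), add_sub_cancel_left]
  | iUnion B hd hB ih =>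
    have hsum : ∀ C : ℕ → Set (Configuration (ℤ × ℝ≥0)), Pairwise (Function.onFun Disjoint C) →
        (∀ i, MeasurableSet (C i)) →
        HasSum (fun i => (P.map X).real (C i)) ((P.map X).real (⋃ i, C i)) := by
      intro C hC hCm
      have h1 : ∑' i, (P.map X) (C i) ≠ ⊤ := by
        rw [← measure_iUnion hC hCm]; exact measure_ne_top _ _
      rw [measureReal_def, measure_iUnion hC hCm,
        ENNReal.tsum_toReal_eq (ENNReal.ne_top_of_tsum_ne_top h1)]
      exact (ENNReal.summable_toReal h1).hasSum
    have hCn : ∀ n : ℕ, HasSum (fun i => (P.map X).real (A ∩ shiftConfig (-n) ⁻¹' B i))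
        ((P.map X).real (A ∩ shiftConfig (-n) ⁻¹' ⋃ i, B i)) := by
      intro n
      rw [Set.preimage_iUnion, Set.inter_iUnion]
      exact hsum _ (fun i j hij => ((hd hij).preimage _).mono Set.inter_subset_right
        Set.inter_subset_right) fun i => hA.inter (measurable_shiftConfig (-n) (hB i))
    rw [← (hsum B hd hB).tsum_eq, ← tsum_mul_left]
    simp only [fun n => (hCn n).tsum_eq.symm]
    -- By translation invariance of the law the `i`-th term is at most the probability of `B i`,
    -- which is summable.
    refine tendsto_tsum_of_dominated_convergence (hsum B hd hB).summable ih
      (Eventually.of_forall fun n i => ?_)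
    rw [Real.norm_of_nonneg measureReal_nonneg,
      ← (hX.measurePreserving_shiftConfig (-n)).measureReal_preimage (hB i).nullMeasurableSet]
    exact measureReal_mono Set.inter_subset_right

end

end EdgeProcess

theorem proposition4p5 {Ω : Type*} [MeasurableSpace Ω] (P : Measure Ω) [IsProbabilityMeasure P]
    (X : Ω → EdgeProcess.Configuration (ℤ × ℝ≥0))
    (hX : EdgeProcess.IsDeterminantal EdgeProcess.edgeKernel EdgeProcess.refMeasure P X)
    (E : Set (EdgeProcess.Configuration (ℤ × ℝ≥0))) (hE : EdgeProcess.IsInvariantEvent E) :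
    P (X ⁻¹' E) = 0 ∨ P (X ⁻¹' E) = 1 := by
  have := Measure.isProbabilityMeasure_map (μ := P) hX.measurable.aemeasurable
  have hindep : ProbabilityTheory.IndepSets (EdgeProcess.avoidEvents (ℤ × ℝ≥0)) {E} (P.map X) := by
    rw [ProbabilityTheory.IndepSets_iff]
    rintro _ _ ⟨U, hU, hUC, rfl⟩ rfl
    -- Invariance makes the mixing sequence constant, so its limit is an equality: `E` is
    -- independent of each avoidance event.
    have hlim := hX.tendsto_avoid_inter_preimage hU hUC hE.1
    simp only [hE.preimage_shiftConfig] at hlim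
    have h := tendsto_nhds_unique tendsto_const_nhds hlim
    rwa [measureReal_def, measureReal_def, measureReal_def, ← ENNReal.toReal_mul,
      ENNReal.toReal_eq_toReal_iff' (measure_ne_top _ _)
        (ENNReal.mul_ne_top (measure_ne_top _ _) (measure_ne_top _ _))] at h
  -- Independence extends from the π-system to the whole sigma-algebra, which contains `E`.
  have hself : ProbabilityTheory.IndepSet E E (P.map X) :=
    ProbabilityTheory.indep_of_indep_of_le_left
      (hindep.indep le_rfl (MeasurableSpace.generateFrom_le fun _ h => h ▸ hE.1)
        (EdgeProcess.isPiSystem_avoidEvents _) (IsPiSystem.singleton E)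
        EdgeProcess.generateFrom_avoidEvents rfl)
      (MeasurableSpace.generateFrom_le fun _ h => h ▸ hE.1)
  rw [← Measure.map_apply hX.measurable hE.1]
  exact ProbabilityTheory.measure_eq_zero_or_one_of_indepSet_self hself
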